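/- Let $\mathbb X$ be a measurable space with measurable diagonal (e.g. a standard Borel space), $\mu$ a $\sigma$-finite measure on $\mathbb X$, and $H(dx)=h(x)\,\mu(dx)$ a nonatomic probability measure with density $h\ge 0$. Let $\lambda:(0,\infty)\to[0,\infty)$ be measurable with $\int_0^\infty(1-e^{-w})\lambda(w)\,dw<\infty$ and $\int_0^\infty\lambda(w)\,dw=\infty$. Let $G=\sum_{j\ge1}w_j\delta_{X_j}\sim\mathrm{CRM}(\lambda,H)$ be the homogeneous completely random measure with Lévy intensity $\lambda$ and base distribution $H$: the masses $(w_j)$ are the points of a Poisson process on $(0,\infty)$ with intensity $\lambda(w)\,dw$, and the locations $(X_j)$ are i.i.d. with law $H$ and independent of the masses. Given $G$, let $Y_\ell=(Y_{\ell 1},\dots,Y_{\ell m})$, $\ell=1,\dots,L$, be i.i.d. Plackett–Luce top-$m$ lists of atoms of $G$, i.e. a list of distinct items has conditional probability $$P(Y_\ell\mid G)=\prod_{i=1}^m\frac{G(\{Y_{\ell i}\})}{G(\mathbb X\setminus\{Y_{\ell1},\dots,Y_{\ell\,i-1}\})},$$ and given $G$ and all the lists let the latent variables $Z_{\ell i}$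 be independent with $Z_{\ell i}\sim\mathrm{Exp}\big(G(\mathbb X\setminus\{Y_{\ell1},\dots,Y_{\ell\,i-1}\})\big)$. Let $X^*_1,\dots,X^*_K$ be the distinct items among the $L$ lists, $n_k$ the number of occurrences of $X^*_k$ in the lists, and $\delta_{\ell ik}=0$ if $Y_{\ell j}=X^*_k$ for some $j<i$, $\delta_{\ell ik}=1$ otherwise. Then $0<G(\mathbb X)<\infty$ almost surely, and the joint law of $(Y_\ell,Z_\ell)_{\ell=1}^L$ has the density $$P\big((Y_\ell,Z_\ell)_{\ell=1}^L\big)=e^{-\psi\left(\sum_{\ell i}Z_{\ell i}\right)}\prod_{k=1}^K h(X^*_k)\,\kappa\Big(n_k,\sum_{\ell i}\delta_{\ell ik}Z_{\ell i}\Big),$$ where $$\psi(z)=-\log\mathbb E\big[e^{-zG(\mathbb X)}\big]=\int_0^\infty(1-e^{-zw})\lambda(w)\,dw\quad(z\ge0),\qquad \kappa(n,z)=\int_0^\infty w^ne^{-zw}\lambda(w)\,dw\quad(n\ge1,\ z>0),$$ and these integrals are finite. The density is with respect to the following reference measure: Lebesgue measure on $(0,\infty)^{Lm}$ for the latent variables,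 times, for the lists (without repetitions inside a list), the sum over all patterns of ties between the $Lm$ positions of the product measure $\prod_{k=1}^K\mu(dx^*_k)$ over the distinct items. -/

import Mathlib

open MeasureTheory ProbabilityTheory Set
open scoped ENNReal NNReal

noncomputable section

namespace PLCRM

/-! ### Poisson processes and homogeneous completely random measures -/

/-- `N` is a Poisson process (Poisson random measure) on `S` with mean measure `ν`: the number of
points in a measurable set of finite mean measure is Poisson distributed, and the numbers of points
in pairwise disjoint measurable sets are independent. -/
structure IsPoissonProcess {Ω S : Type*} [MeasurableSpace Ω] [MeasurableSpace S]
    (P : Measure Ω) (ν : Measure S) (N : Ω → Measure S) : Prop where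
  measurable : Measurable N
  map_eq : ∀ B : Set S, MeasurableSet B → ν B ≠ ∞ →
    P.map (fun ω => N ω B) = (poissonMeasure (ν B).toNNReal).map (fun n : ℕ => (n : ℝ≥0∞))
  indep : ∀ (n : ℕ) (B : Fin n → Set S), (∀ i, MeasurableSet (B i)) →
    Pairwise (fun i j => Disjoint (B i) (B j)) → iIndepFun (fun i ω => N ω (B i)) P

/-- The Lévy measure `lam(w) dw` on `(0, ∞)`, seen as a measure on `ℝ`. -/
def levyMeasure (lam : ℝ → ℝ≥0) : Measure ℝ :=
  (volume.restrict (Ioi 0)).withDensity (fun w => (lam w : ℝ≥0∞))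

/-- The atomic measure `∑ j, w j δ_{x j}`. -/
def atomicMeasure {𝕏 : Type*} [MeasurableSpace 𝕏] (w : ℕ → ℝ) (x : ℕ → 𝕏) : Measure 𝕏 :=
  Measure.sum fun j => ENNReal.ofReal (w j) • Measure.dirac (x j)

/-- `G ∼ CRM(lam, H)`: `G = ∑ j, w j δ_{X j}` almost surely, where the masses `w j` are the points
of a Poisson process on `(0, ∞)` with intensity `lam`, and the locations `X j` are i.i.d. with law
`H` and independent of the masses. -/
def IsCRM {Ω 𝕏 : Type*} [MeasurableSpace Ω] [MeasurableSpace 𝕏]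
    (P : Measure Ω) (lam : ℝ → ℝ≥0) (H : Measure 𝕏) (G : Ω → Measure 𝕏) : Prop :=
  Measurable G ∧
  ∃ (w : ℕ → Ω → ℝ) (X : ℕ → Ω → 𝕏),
    (∀ j, Measurable (w j)) ∧ (∀ j, Measurable (X j)) ∧
    IsPoissonProcess P (levyMeasure lam)
      (fun ω => Measure.sum fun j => Measure.dirac (w j ω)) ∧
    (∀ j, P.map (X j) = H) ∧ iIndepFun X P ∧
    IndepFun (fun ω j => w j ω) (fun ω j => X j ω) P ∧
    ∀ᵐ ω ∂P, G ω = atomicMeasure (fun j => w j ω) (fun j => X j ω)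

/-! ### The Plackett–Luce model given a random atomic measure -/

/-- `𝕏 ∖ {y 1, …, y (i - 1)}`: the items that are still available at stage `i`. -/
def remaining {𝕏 : Type*} {m : ℕ} (y : Fin m → 𝕏) (i : Fin m) : Set 𝕏 :=
  {x | ∀ j, j < i → y j ≠ x}

open Classical in
/-- The Plackett–Luce law of a top-`m` list when the items and their ratings are the atoms of `g`:
for an atomic measure `g`, the list `y` of distinct items has probability
`∏ i, g {y i} / g (𝕏 ∖ {y 1, …, y (i - 1)})`, and lists with repetitions have probability zero. -/
def plackettLuce {𝕏 : Type*} [MeasurableSpace 𝕏] (g : Measure 𝕏) (m : ℕ) :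
    Measure (Fin m → 𝕏) :=
  (Measure.pi fun _ : Fin m => g).withDensity fun y =>
    if Function.Injective y then ∏ i, (g (remaining y i))⁻¹ else 0

/-- `Y` consists of `L` top-`m` lists and `Z` of their latent inter-arrival times:
given `G`, the lists are i.i.d. Plackett–Luce lists; given `G` and the lists, the times `Z ℓ i` are
independent, exponential with rate `G (𝕏 ∖ {Y ℓ 1, …, Y ℓ (i - 1)})`. -/
structure IsPlackettLuceSample {Ω 𝕏 : Type*} [MeasurableSpace Ω] [MeasurableSpace 𝕏] {L m : ℕ}
    (P : Measure Ω) (G : Ω → Measure 𝕏)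
    (Y : Ω → Fin L → Fin m → 𝕏) (Z : Ω → Fin L → Fin m → ℝ) : Prop where
  measurable_lists : Measurable Y
  measurable_times : Measurable Z
  cond_lists : ∀ A : Set (Fin L → Fin m → 𝕏), MeasurableSet A →
    P⟦Y ⁻¹' A | MeasurableSpace.comap G inferInstance⟧
      =ᵐ[P] fun ω => (Measure.pi fun _ : Fin L => plackettLuce (G ω) m).real A
  cond_times : ∀ B : Set (Fin L → Fin m → ℝ), MeasurableSet B →
    P⟦Z ⁻¹' B | MeasurableSpace.comap (fun ω => (G ω, Y ω)) inferInstance⟧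
      =ᵐ[P] fun ω => (Measure.pi fun ℓ : Fin L => Measure.pi fun i : Fin m =>
        expMeasure (G ω (remaining (Y ω ℓ) i)).toReal).real B

/-! ### The marginal density -/

/-- `ψ(z) = ∫₀^∞ (1 - e^{-zw}) lam(w) dw`. -/
def psi (lam : ℝ → ℝ≥0) (z : ℝ) : ℝ :=
  ∫ w in Ioi (0 : ℝ), (1 - Real.exp (-z * w)) * (lam w : ℝ)

/-- `κ(n, z) = ∫₀^∞ wⁿ e^{-zw} lam(w) dw`. -/
def kappa (lam : ℝ → ℝ≥0) (n : ℕ) (z : ℝ) : ℝ :=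
  ∫ w in Ioi (0 : ℝ), w ^ n * Real.exp (-z * w) * (lam w : ℝ)

open Classical in
/-- The set of the distinct items (`X*_1, …, X*_K`) in the lists `y`. -/
def items {𝕏 : Type*} {L m : ℕ} (y : Fin L → Fin m → 𝕏) : Finset 𝕏 :=
  Finset.univ.image fun p : Fin L × Fin m => y p.1 p.2

open Classical in
/-- The number of occurrences of the item `x` in the lists `y`. -/
def occ {𝕏 : Type*} {L m : ℕ} (y : Fin L → Fin m → 𝕏) (x : 𝕏) : ℕ :=
  (Finset.univ.filter fun p : Fin L × Fin m => y p.1 p.2 = x).card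

open Classical in
/-- The occurrence indicator: `0` if `x` stands before position `i` in list `ℓ`, else `1`. -/
def delta {𝕏 : Type*} {L m : ℕ} (y : Fin L → Fin m → 𝕏) (ℓ : Fin L) (i : Fin m) (x : 𝕏) : ℝ :=
  if ∃ j, j < i ∧ y ℓ j = x then 0 else 1

/-- `e^{-ψ(∑ z)} ∏_{x an item of y} h(x) κ(n_x, ∑_{ℓ i} δ_{ℓ i x} z_{ℓ i})`. -/
def marginalDensity {𝕏 : Type*} {L m : ℕ} (lam : ℝ → ℝ≥0) (h : 𝕏 → ℝ≥0)
    (y : Fin L → Fin m → 𝕏) (z : Fin L → Fin m → ℝ) : ℝ :=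
  Real.exp (-psi lam (∑ ℓ, ∑ i, z ℓ i)) *
    ∏ x ∈ items y, (h x : ℝ) * kappa lam (occ y x) (∑ ℓ, ∑ i, delta y ℓ i x * z ℓ i)

open Classical in
/-- The reference measure for `L` lists of length `m`. Items may be shared between lists, so there
is one part for every pattern of ties `s` (an equivalence relation on the positions `(ℓ, i)`):
on the lists whose ties are exactly those of `s`, it is the product `∏_k μ(dx_k)` over the distinct
items, one for each class of `s`. Only lists without repetitions are kept. -/
def listsRef {𝕏 : Type*} [MeasurableSpace 𝕏] (μ : Measure 𝕏) (L m : ℕ) :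
    Measure (Fin L → Fin m → 𝕏) :=
  (Measure.sum fun s : Setoid (Fin L × Fin m) =>
    ((Measure.pi fun _ : Quotient s => μ).restrict {x | Function.Injective x}).map
      (fun x ℓ i => x (Quotient.mk s (ℓ, i)))).restrict {y | ∀ ℓ, Function.Injective (y ℓ)}

/-- The reference measure for lists and latent times: `listsRef` times Lebesgue measure on the
positive times. -/
def dataRef {𝕏 : Type*} [MeasurableSpace 𝕏] (μ : Measure 𝕏) (L m : ℕ) :
    Measure ((Fin L → Fin m → 𝕏) × (Fin L → Fin m → ℝ)) :=
  (listsRef μ L m).prod (volume.restrict {z | ∀ ℓ i, 0 < z ℓ i})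

end PLCRM

end

/-! The latent times are there to remove the normalising constants. Given the masses, an item of
mass `w` chosen at a stage with remaining mass `R` contributes `w / R` for the choice and `R
e^{-Rz}` for the time, hence `w e^{-Rz}` (`listWeight_mul_timesDensity`). Collecting exponents atom
by atom (`labelDensity_eq`), an atom listed `n` times contributes `w^n e^{-cw}`, where `c` is the
total time during which it is still available, and an unlisted atom contributes `e^{-w ∑ z}`. So for
a fixed pattern of ties one has to sum, over injective assignments of atoms to the classes of the
pattern, a product over the chosen points times an exponential functional of all other points of the
Poisson process of masses.

The expectation of such a sum is given by the multivariate Palm formula `palm_formula`: each chosen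
point is integrated against the Lévy measure, giving a factor `κ`, and the other points contribute
the Laplace functional, giving `e^{-ψ}`. The formula is obtained from the Laplace functional
(`IsPoissonProcess.laplace`) by induction on the number of chosen points: one more point appears on
differentiating in the test function.

The locations are independent of the masses and i.i.d. with law `H`, so they only contribute the
probability that i.i.d. items arranged along the pattern give the observed lists, whatever labels
the atoms carry; this is the factor `∏ h(x_k) μ(dx_k)`. The conditional laws are given with respect
to `G`, not to its labelled atoms, so they are first integrated and only then expanded over labels
(`map_measure_lists`, `measure_lists_times`). The joint law and the proposed density are then the
same sum over patterns of ties on every rectangle (`measure_rectangle_eq`,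
`dataRef_withDensity_rectangle`). -/

noncomputable section

namespace PLCRM

/-! ### The function `x ↦ e^{-x}` on `[0, ∞]` -/

/-- `e^{-x}` for `x ∈ [0, ∞]`, with `e^{-∞} = 0`. -/
def expNeg (x : ℝ≥0∞) : ℝ≥0∞ := EReal.exp (-(x : EReal))

@[simp] lemma expNeg_zero : expNeg 0 = 1 := by simp [expNeg]

@[simp] lemma expNeg_top : expNeg ∞ = 0 := by simp [expNeg]

lemma expNeg_ofReal {r : ℝ} (hr : 0 ≤ r) :
    expNeg (ENNReal.ofReal r) = ENNReal.ofReal (Real.exp (-r)) := by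
  rw [expNeg, EReal.coe_ennreal_ofReal, max_eq_left hr, ← EReal.coe_neg, EReal.exp_coe]

lemma expNeg_coe (r : ℝ≥0) : expNeg r = ENNReal.ofReal (Real.exp (-r)) := by
  rw [← expNeg_ofReal r.coe_nonneg, ENNReal.ofReal_coe_nnreal]

lemma expNeg_of_ne_top {x : ℝ≥0∞} (hx : x ≠ ∞) :
    expNeg x = ENNReal.ofReal (Real.exp (-x.toReal)) := by
  rw [← expNeg_ofReal ENNReal.toReal_nonneg, ENNReal.ofReal_toReal hx]

lemma expNeg_add (x y : ℝ≥0∞) : expNeg (x + y) = expNeg x * expNeg y := by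
  induction x with
  | top => simp
  | coe x =>
    induction y with
    | top => simp
    | coe y =>
      rw [← ENNReal.coe_add, expNeg_coe, expNeg_coe, expNeg_coe,
        ← ENNReal.ofReal_mul (Real.exp_nonneg _), ← Real.exp_add]
      congr 2
      push_cast
      ring

lemma expNeg_sum {ι : Type*} (s : Finset ι) (f : ι → ℝ≥0∞) :
    expNeg (∑ i ∈ s, f i) = ∏ i ∈ s, expNeg (f i) := by
  classical
  induction s using Finset.induction_on with
  | empty => simp
  | insert a s ha ih => rw [Finset.sum_insert ha, Finset.prod_insert ha, expNeg_add, ih]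

lemma expNeg_mul_natCast (x : ℝ≥0∞) (n : ℕ) : expNeg (x * n) = expNeg x ^ n := by
  induction n with
  | zero => simp
  | succ n ih => rw [Nat.cast_succ, mul_add, expNeg_add, ih, mul_one, pow_succ]

lemma antitone_expNeg : Antitone expNeg := fun x y hxy => by
  unfold expNeg
  exact EReal.exp_monotone (EReal.neg_le_neg_iff.2 (EReal.coe_ennreal_le_coe_ennreal_iff.2 hxy))

lemma expNeg_le_one (x : ℝ≥0∞) : expNeg x ≤ 1 := by
  simpa using antitone_expNeg zero_le

lemma expNeg_ne_top (x : ℝ≥0∞) : expNeg x ≠ ∞ :=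
  ne_top_of_le_ne_top ENNReal.one_ne_top (expNeg_le_one x)

lemma continuous_expNeg : Continuous expNeg :=
  ENNReal.continuous_exp.comp (continuous_neg.comp continuous_coe_ennreal_ereal)

@[fun_prop] lemma measurable_expNeg : Measurable expNeg := continuous_expNeg.measurable

/-! ### The Laplace functional of a Poisson process -/

section Laplace

variable {Ω S : Type*} [MeasurableSpace Ω] [MeasurableSpace S] {P : Measure Ω} {ν : Measure S}
  {N : Ω → Measure S}

/-- This is the exponential series at `a e^{-r}`, multiplied by `e^{-a}`. -/
lemma lintegral_expNeg_poisson (a : ℝ≥0) {r : ℝ≥0∞} (hr : r ≠ ∞) :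
    ∫⁻ n : ℕ, expNeg (r * n) ∂(poissonMeasure a) = expNeg (a * (1 - expNeg r)) := by
  lift r to ℝ≥0 using hr
  have hp : Real.exp (-(r : ℝ)) ≤ 1 := Real.exp_le_one_iff.2 (by simp)
  set p := Real.exp (-(r : ℝ)) with hpdef
  have hp0 : 0 ≤ p := (Real.exp_pos _).le
  have h1 : (a : ℝ≥0∞) * (1 - expNeg r) = ENNReal.ofReal (a * (1 - p)) := by
    rw [expNeg_coe, ENNReal.ofReal_mul a.coe_nonneg, ENNReal.ofReal_coe_nnreal,
      ENNReal.ofReal_sub _ hp0, ENNReal.ofReal_one]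
  rw [h1, expNeg_ofReal (mul_nonneg a.coe_nonneg (sub_nonneg.2 hp)), poissonMeasure,
    lintegral_sum_measure]
  have h2 : ∀ n : ℕ, ∫⁻ k : ℕ, expNeg (r * k)
      ∂(ENNReal.ofReal (Real.exp (-a) * a ^ n / n.factorial) • Measure.dirac n)
      = ENNReal.ofReal (Real.exp (-a) * ((a * p) ^ n / n.factorial)) := by
    intro n
    rw [lintegral_smul_measure, lintegral_dirac, expNeg_mul_natCast, expNeg_coe,
      ← ENNReal.ofReal_pow hp0, smul_eq_mul, ← ENNReal.ofReal_mul (by positivity)]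
    congr 1
    rw [mul_pow]
    ring
  have h3 : HasSum (fun n : ℕ => Real.exp (-a) * ((a * p) ^ n / n.factorial))
      (Real.exp (-a) * Real.exp (a * p)) := by
    rw [Real.exp_eq_exp_ℝ]
    exact (NormedSpace.expSeries_div_hasSum_exp (a * p : ℝ)).mul_left _
  simp_rw [h2]
  rw [← ENNReal.ofReal_tsum_of_nonneg (fun n => by positivity) h3.summable, h3.tsum_eq,
    ← Real.exp_add]
  congr 2
  ring

lemma IsPoissonProcess.lintegral_expNeg_mul (hN : IsPoissonProcess P ν N) {B : Set S}
    (hB : MeasurableSet B) (hν : ν B ≠ ∞) {r : ℝ≥0∞} (hr : r ≠ ∞) :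
    ∫⁻ ω, expNeg (r * N ω B) ∂P = expNeg (ν B * (1 - expNeg r)) := by
  have hNB : Measurable fun ω => N ω B := (Measure.measurable_coe hB).comp hN.measurable
  have hm : Measurable fun x : ℝ≥0∞ => expNeg (r * x) := by fun_prop
  rw [← lintegral_map (f := fun x => expNeg (r * x)) hm hNB, hN.map_eq B hB hν,
    lintegral_map hm .of_discrete, lintegral_expNeg_poisson _ hr, ENNReal.coe_toNNReal hν]

/-- Level sets for distinct values are disjoint, so their counts are independent Poisson variables
and the expectation factorises over the values. -/
lemma IsPoissonProcess.laplace_simpleFunc (hN : IsPoissonProcess P ν N) (φ : SimpleFunc S ℝ≥0∞)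
    (hφ : ∀ r, r ≠ 0 → ν (φ ⁻¹' {r}) ≠ ∞) (hφ' : ∀ x, φ x ≠ ∞) :
    ∫⁻ ω, expNeg (∫⁻ x, φ x ∂(N ω)) ∂P = expNeg (∫⁻ x, (1 - expNeg (φ x)) ∂ν) := by
  classical
  -- The value `0` is dropped: its level set may have infinite mean measure, and it adds nothing to
  -- either integral.
  set F := φ.range.filter (· ≠ 0) with hF
  have hFtop : ∀ r ∈ F, r ≠ ∞ := by
    intro r hr
    obtain ⟨x, rfl⟩ := SimpleFunc.mem_range.1 (Finset.mem_filter.1 hr).1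
    exact hφ' x
  have h1 : ∀ ω, ∫⁻ x, φ x ∂(N ω) = ∑ r ∈ F, r * N ω (φ ⁻¹' {r}) := by
    intro ω
    rw [SimpleFunc.lintegral_eq_lintegral, SimpleFunc.lintegral, hF, Finset.sum_filter]
    refine Finset.sum_congr rfl fun r _ => ?_
    by_cases hr : r = 0 <;> simp [hr]
  have h2 : ∫⁻ x, (1 - expNeg (φ x)) ∂ν = ∑ r ∈ F, ν (φ ⁻¹' {r}) * (1 - expNeg r) := by
    have : (fun x => 1 - expNeg (φ x)) = φ.map (fun r => 1 - expNeg r) := by ext; simp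
    rw [this, SimpleFunc.lintegral_eq_lintegral, SimpleFunc.map_lintegral, hF, Finset.sum_filter]
    refine Finset.sum_congr rfl fun r _ => ?_
    by_cases hr : r = 0 <;> simp [hr, mul_comm]
  rw [h2, expNeg_sum]
  simp_rw [h1, expNeg_sum]
  let e := F.equivFin
  have hind := (hN.indep F.card (fun i => φ ⁻¹' {(e.symm i : ℝ≥0∞)})
    (fun i => φ.measurableSet_preimage _) (fun i j hij => by
      refine Disjoint.preimage _ (disjoint_singleton.2 fun h => hij ?_)
      exact e.symm.injective (Subtype.ext h))).comp
    (fun i x => expNeg ((e.symm i : ℝ≥0∞) * x)) (fun i => by fun_prop)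
  have hmeas : ∀ r, Measurable fun ω => N ω (φ ⁻¹' {r}) := fun r =>
    (Measure.measurable_coe (φ.measurableSet_preimage _)).comp hN.measurable
  have h3 := lintegral_prod_eq_prod_lintegral_of_indepFun Finset.univ _ hind
    (fun i => by
      have := hmeas (e.symm i : ℝ≥0∞)
      simp only [Function.comp_def]
      fun_prop)
  simp only [Function.comp_def] at h3
  have h4 : ∀ ω, ∏ r ∈ F, expNeg (r * N ω (φ ⁻¹' {r}))
      = ∏ i, expNeg ((e.symm i : ℝ≥0∞) * N ω (φ ⁻¹' {(e.symm i : ℝ≥0∞)})) := by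
    intro ω
    rw [← Finset.prod_coe_sort, ← e.symm.prod_comp]
  simp_rw [h4, h3]
  rw [← Finset.prod_coe_sort F, ← e.symm.prod_comp]
  refine Finset.prod_congr rfl fun i _ => ?_
  exact hN.lintegral_expNeg_mul (φ.measurableSet_preimage _)
    (hφ _ (Finset.mem_filter.1 (e.symm i).2).2) (hFtop _ (e.symm i).2)

/-- Increasing finite-valued simple functions supported in sets of finite measure reduce the claim
to `laplace_simpleFunc`. On the left the limit passes by domination by `1`, on the right by monotone
convergence. -/
theorem IsPoissonProcess.laplace [IsProbabilityMeasure P] [SigmaFinite ν]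
    (hN : IsPoissonProcess P ν N) {φ : S → ℝ≥0∞} (hφ : Measurable φ) :
    ∫⁻ ω, expNeg (∫⁻ x, φ x ∂(N ω)) ∂P = expNeg (∫⁻ x, (1 - expNeg (φ x)) ∂ν) := by
  let ψ : ℕ → SimpleFunc S ℝ≥0∞ := fun n => (SimpleFunc.eapprox φ n).restrict (spanningSets ν n)
  have hψ : ∀ n x, ψ n x = (spanningSets ν n).indicator (SimpleFunc.eapprox φ n) x := fun n x =>
    SimpleFunc.restrict_apply _ (measurableSet_spanningSets ν n) x
  have hmono : ∀ x, Monotone fun n => ψ n x := by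
    intro x n k hnk
    simp only [hψ]
    refine (indicator_le_indicator_of_subset (monotone_spanningSets ν hnk) (fun _ => zero_le)
      x).trans (indicator_le_indicator (SimpleFunc.monotone_eapprox φ hnk x))
  have hsup : ∀ x, ⨆ n, ψ n x = φ x := by
    intro x
    refine le_antisymm (iSup_le fun n => ?_) ?_
    · rw [hψ]
      refine (indicator_le_self' (fun _ _ => zero_le) x).trans ?_
      rw [← SimpleFunc.iSup_eapprox_apply hφ x]
      exact le_iSup (fun n => SimpleFunc.eapprox φ n x) n
    · rw [← SimpleFunc.iSup_eapprox_apply hφ x]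
      refine iSup_le fun n => ?_
      have hx := mem_spanningSetsIndex ν x
      refine le_iSup_of_le (max n (spanningSetsIndex ν x)) ?_
      rw [hψ, indicator_of_mem (monotone_spanningSets ν (le_max_right _ _) hx)]
      exact SimpleFunc.monotone_eapprox φ (le_max_left _ _) x
  have hlim : ∀ x, Filter.Tendsto (fun n => ψ n x) Filter.atTop (nhds (φ x)) := fun x => by
    rw [← hsup x]
    exact tendsto_atTop_iSup (hmono x)
  have hbase : ∀ n, ∫⁻ ω, expNeg (∫⁻ x, ψ n x ∂(N ω)) ∂P
      = expNeg (∫⁻ x, (1 - expNeg (ψ n x)) ∂ν) := by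
    intro n
    refine hN.laplace_simpleFunc (ψ n) (fun r hr => ?_) (fun x => ?_)
    · refine ne_top_of_le_ne_top (measure_spanningSets_lt_top ν n).ne (measure_mono ?_)
      intro x hx
      by_contra hxs
      apply hr
      rw [← (hx : ψ n x = r), hψ, indicator_of_notMem hxs]
    · rw [hψ]
      refine ne_top_of_le_ne_top (SimpleFunc.eapprox_lt_top φ n x).ne ?_
      exact indicator_le_self' (fun _ _ => zero_le) x
  have hNmeas : ∀ n, Measurable fun ω => ∫⁻ x, ψ n x ∂(N ω) := fun n =>
    (Measure.measurable_lintegral (ψ n).measurable).comp hN.measurable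
  have hL : Filter.Tendsto (fun n => ∫⁻ ω, expNeg (∫⁻ x, ψ n x ∂(N ω)) ∂P) Filter.atTop
      (nhds (∫⁻ ω, expNeg (∫⁻ x, φ x ∂(N ω)) ∂P)) := by
    refine tendsto_lintegral_of_dominated_convergence (fun _ => 1)
      (fun n => measurable_expNeg.comp (hNmeas n)) (fun n => ae_of_all _ fun ω => expNeg_le_one _)
      (by simp) (ae_of_all _ fun ω => (continuous_expNeg.tendsto _).comp ?_)
    exact lintegral_tendsto_of_tendsto_of_monotone (fun n => (ψ n).measurable.aemeasurable)
      (ae_of_all _ hmono) (ae_of_all _ hlim)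
  have hR : Filter.Tendsto (fun n => expNeg (∫⁻ x, (1 - expNeg (ψ n x)) ∂ν)) Filter.atTop
      (nhds (expNeg (∫⁻ x, (1 - expNeg (φ x)) ∂ν))) := by
    refine (continuous_expNeg.tendsto _).comp ?_
    refine lintegral_tendsto_of_tendsto_of_monotone (fun n => ?_) (ae_of_all _ fun x n k hnk => ?_)
      (ae_of_all _ fun x => ?_)
    · have := (ψ n).measurable
      fun_prop
    · exact tsub_le_tsub_left (antitone_expNeg (hmono x hnk)) 1
    · exact ENNReal.Tendsto.sub tendsto_const_nhds ((continuous_expNeg.tendsto _).comp (hlim x))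
        (Or.inl ENNReal.one_ne_top)
  simp_rw [hbase] at hL
  exact tendsto_nhds_unique hL hR

end Laplace

/-! ### The multivariate Palm formula for multiplicative functionals -/

lemma one_sub_expNeg_le (s : ℝ≥0∞) : 1 - expNeg s ≤ s := by
  induction s with
  | top => simp
  | coe s =>
    rw [expNeg_coe, ← ENNReal.ofReal_one, ← ENNReal.ofReal_sub _ (Real.exp_pos _).le,
      ← ENNReal.ofReal_coe_nnreal]
    exact ENNReal.ofReal_le_ofReal (by linarith [Real.add_one_le_exp (-(s : ℝ))])

/-- Equivalent for finite `s` to `e^{-s} (1 + s) ≤ 1`. It is the lower half of the squeeze `s / (1 +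
s) ≤ 1 - e^{-s} ≤ s`. -/
lemma le_one_sub_expNeg_mul (s : ℝ≥0∞) : s ≤ (1 - expNeg s) * (1 + s) := by
  induction s with
  | top => simp
  | coe s =>
    rw [expNeg_coe, ← ENNReal.ofReal_one, ← ENNReal.ofReal_sub _ (Real.exp_pos _).le,
      ← ENNReal.ofReal_coe_nnreal, ← ENNReal.ofReal_add zero_le_one s.coe_nonneg,
      ← ENNReal.ofReal_mul (by simp)]
    refine ENNReal.ofReal_le_ofReal ?_
    have h1 := Real.add_one_le_exp (s : ℝ)
    have h2 : Real.exp (-(s : ℝ)) * Real.exp s = 1 := by rw [← Real.exp_add]; simp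
    nlinarith [Real.exp_pos (-(s : ℝ))]

lemma tendsto_mul_one_sub_expNeg {c s : ℕ → ℝ≥0∞} {a : ℝ≥0∞}
    (hs : Filter.Tendsto s Filter.atTop (nhds 0))
    (hcs : Filter.Tendsto (fun n => c n * s n) Filter.atTop (nhds a)) :
    Filter.Tendsto (fun n => c n * (1 - expNeg (s n))) Filter.atTop (nhds a) := by
  have h1 : Filter.Tendsto (fun n => c n * s n / (1 + s n)) Filter.atTop (nhds a) := by
    have := ENNReal.Tendsto.div hcs (Or.inr (by simp))
      ((tendsto_const_nhds (x := (1 : ℝ≥0∞))).add hs) (Or.inl (by simp))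
    simpa using this
  refine tendsto_of_tendsto_of_tendsto_of_le_of_le h1 hcs (fun n => ?_)
    (fun n => mul_le_mul_right (one_sub_expNeg_le _) _)
  refine ENNReal.div_le_of_le_mul ?_
  rw [mul_assoc]
  exact mul_le_mul_right (le_one_sub_expNeg_mul _) _

/-- `2ⁿ (1 - e^{-y/2ⁿ})`, which increases to `y`. -/
def dyadicQuot (n : ℕ) (y : ℝ≥0∞) : ℝ≥0∞ := 2 ^ n * (1 - expNeg (((2 : ℝ≥0)⁻¹ ^ n : ℝ≥0) * y))

@[fun_prop] lemma measurable_dyadicQuot (n : ℕ) : Measurable (dyadicQuot n) := by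
  unfold dyadicQuot; fun_prop

lemma two_pow_mul_half_pow (n : ℕ) : (2 : ℝ≥0∞) ^ n * ((2 : ℝ≥0)⁻¹ ^ n : ℝ≥0) = 1 := by
  rw [ENNReal.coe_pow, ENNReal.coe_inv two_ne_zero, ENNReal.coe_ofNat, ← mul_pow,
    ENNReal.mul_inv_cancel two_ne_zero ENNReal.ofNat_ne_top, one_pow]

lemma tendsto_half_pow : Filter.Tendsto (fun n : ℕ => (((2 : ℝ≥0)⁻¹ ^ n : ℝ≥0) : ℝ≥0∞))
    Filter.atTop (nhds 0) := by
  have := NNReal.tendsto_pow_atTop_nhds_zero_of_lt_one (r := 2⁻¹) (by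
    rw [← NNReal.coe_lt_coe]; norm_num)
  exact ENNReal.tendsto_coe.2 this

/-- With `u = e^{-y/2^{n+1}} ≤ 1` this is `1 - u² ≤ 2 (1 - u)`. Because of the monotonicity,
derivatives along `t = 2⁻ⁿ` can be taken under sums and integrals without any domination. -/
lemma monotone_dyadicQuot (y : ℝ≥0∞) : Monotone fun n => dyadicQuot n y := by
  refine monotone_nat_of_le_succ fun n => ?_
  unfold dyadicQuot
  set z : ℝ≥0∞ := ((2 : ℝ≥0)⁻¹ ^ (n + 1) : ℝ≥0) * y with hz
  have h1 : (((2 : ℝ≥0)⁻¹ ^ n : ℝ≥0) : ℝ≥0∞) * y = z + z := by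
    rw [hz, ← add_mul, ← ENNReal.coe_add]
    congr 2
    rw [pow_succ, ← mul_add]
    rw [← NNReal.coe_inj]; push_cast; ring
  rw [h1, expNeg_add, pow_succ, mul_assoc]
  refine mul_le_mul_right ?_ _
  set u := expNeg z
  have hu : u ≤ 1 := expNeg_le_one z
  rw [tsub_le_iff_right, two_mul]
  have h2 : (1 - u) + u = 1 := tsub_add_cancel_of_le hu
  calc (1 : ℝ≥0∞) = (1 - u) + ((1 - u) + u) * u := by rw [h2, one_mul, h2]
    _ = (1 - u) + ((1 - u) * u + u * u) := by rw [add_mul]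
    _ ≤ (1 - u) + ((1 - u) * 1 + u * u) := by gcongr
    _ = 1 - u + (1 - u) + u * u := by rw [mul_one, add_assoc]

lemma tendsto_dyadicQuot (y : ℝ≥0∞) :
    Filter.Tendsto (fun n => dyadicQuot n y) Filter.atTop (nhds y) := by
  by_cases hy : y = ∞
  · have h : ∀ n, dyadicQuot n y = 2 ^ n := fun n => by
      rw [dyadicQuot, hy, ENNReal.mul_top (by simp)]
      simp
    simp_rw [h, hy]
    exact ENNReal.tendsto_pow_atTop_nhds_top_iff.2 (by norm_num)
  · refine tendsto_mul_one_sub_expNeg ?_ ?_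
    · simpa using ENNReal.Tendsto.mul_const tendsto_half_pow (Or.inr hy)
    · simp_rw [← mul_assoc, two_pow_mul_half_pow, one_mul]
      exact tendsto_const_nhds

section Palm

variable {Ω S : Type*} [MeasurableSpace Ω] [MeasurableSpace S] {P : Measure Ω} {ν : Measure S}
  {w : ℕ → Ω → S}

/-- The sum of `φ` over the points that are not labelled by `s`. -/
def tailSum (s : Set ℕ) (φ : S → ℝ≥0) (x : ℕ → S) : ℝ≥0∞ :=
  ∑' j, sᶜ.indicator (fun j => (φ (x j) : ℝ≥0∞)) j

omit [MeasurableSpace S] in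
lemma tailSum_add_smul (s : Set ℕ) (φ g : S → ℝ≥0) (t : ℝ≥0) (x : ℕ → S) :
    tailSum s (fun y => φ y + t * g y) x = tailSum s φ x + t * tailSum s g x := by
  unfold tailSum
  rw [← ENNReal.tsum_mul_left, ← ENNReal.tsum_add]
  refine tsum_congr fun j => ?_
  by_cases hj : j ∈ sᶜ <;> simp [hj]

omit [MeasurableSpace S] in
lemma tailSum_eq_add_insert {s : Set ℕ} {j : ℕ} (hj : j ∉ s) (φ : S → ℝ≥0) (x : ℕ → S) :
    tailSum s φ x = φ (x j) + tailSum (insert j s) φ x := by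
  classical
  unfold tailSum
  rw [← tsum_ite_eq j (fun j => (φ (x j) : ℝ≥0∞)), ← ENNReal.tsum_add]
  refine tsum_congr fun k => ?_
  by_cases hk : k = j
  · subst hk; simp [hj]
  · by_cases hks : k ∈ s <;> simp [hk, hks, indicator]

lemma measurable_tailSum (hw : ∀ j, Measurable (w j)) (s : Set ℕ) {φ : S → ℝ≥0}
    (hφ : Measurable φ) : Measurable fun ω => tailSum s φ (fun j => w j ω) := by
  unfold tailSum
  refine Measurable.tsum fun j => ?_
  by_cases hj : j ∈ sᶜ
  · simp only [indicator_of_mem hj]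
    exact (hφ.comp (hw j)).coe_nnreal_ennreal
  · simp only [indicator_of_notMem hj]
    exact measurable_const

/-- Monotone convergence for the counting measure. -/
lemma tendsto_tsum_of_monotone {ι : Type*} {u : ℕ → ι → ℝ≥0∞} {v : ι → ℝ≥0∞}
    (hu : ∀ i, Monotone fun n => u n i)
    (huv : ∀ i, Filter.Tendsto (fun n => u n i) Filter.atTop (nhds (v i))) :
    Filter.Tendsto (fun n => ∑' i, u n i) Filter.atTop (nhds (∑' i, v i)) := by
  let : MeasurableSpace ι := ⊤
  simp_rw [← lintegral_count]
  exact lintegral_tendsto_of_tendsto_of_monotone (fun n => measurable_from_top.aemeasurable)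
    (ae_of_all _ hu) (ae_of_all _ huv)

/-- Induction on the number of chosen points, the Laplace functional being the case of none. To gain
a point, the formula at `φ + t g` is differentiated at `t = 0`. On the left this brings down the sum
of `g` over the points not yet chosen, that is, a further distinct point; on the right it brings
down `∫ e^{-φ} g dν`. The quantifier over `φ` stays inside the induction because the hypothesis is
used at `φ + t g`, and finiteness of the integrals of `f` makes the differences meaningful in `[0,
∞]`. -/
theorem palm_formula [IsProbabilityMeasure P] [SigmaFinite ν]
    (hN : IsPoissonProcess P ν (fun ω => Measure.sum fun j => Measure.dirac (w j ω)))
    (hw : ∀ j, Measurable (w j)) {α : Type*} [Fintype α] :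
    ∀ (f : α → S → ℝ≥0), (∀ a, Measurable (f a)) → (∀ a, ∫⁻ x, f a x ∂ν ≠ ∞) →
    ∀ φ : S → ℝ≥0, Measurable φ →
    ∫⁻ ω, ∑' ι : α ↪ ℕ, (∏ a, (f a (w (ι a) ω) : ℝ≥0∞)) *
        expNeg (tailSum (range ι) φ (fun j => w j ω)) ∂P
      = (∏ a, ∫⁻ x, f a x ∂ν) * expNeg (∫⁻ x, (1 - expNeg (φ x)) ∂ν) := by
  refine Fintype.induction_empty_option (P := fun (α : Type _) [Fintype α] =>
    ∀ (f : α → S → ℝ≥0), (∀ a, Measurable (f a)) → (∀ a, ∫⁻ x, f a x ∂ν ≠ ∞) →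
    ∀ φ : S → ℝ≥0, Measurable φ →
    ∫⁻ ω, ∑' ι : α ↪ ℕ, (∏ a, (f a (w (ι a) ω) : ℝ≥0∞)) *
        expNeg (tailSum (range ι) φ (fun j => w j ω)) ∂P
      = (∏ a, ∫⁻ x, f a x ∂ν) * expNeg (∫⁻ x, (1 - expNeg (φ x)) ∂ν)) ?_ ?_ ?_ α
  · intro α β _ e ih f hf hfin φ hφ
    let := Fintype.ofEquiv β e.symm
    have := ih (fun a => f (e a)) (fun a => hf _) (fun a => hfin _) φ hφ
    have h1 : ∏ a, ∫⁻ x, f (e a) x ∂ν = ∏ b, ∫⁻ x, f b x ∂ν :=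
      Fintype.prod_equiv e _ _ fun a => rfl
    rw [← h1, ← this]
    refine lintegral_congr fun ω => ?_
    rw [← (Equiv.embeddingCongr e (Equiv.refl ℕ)).tsum_eq]
    refine tsum_congr fun ι => ?_
    congr 1
    · refine (Fintype.prod_equiv e _ _ fun a => ?_).symm
      simp
    · congr 2
      ext j
      simp only [mem_range]
      constructor
      · rintro ⟨b, rfl⟩
        exact ⟨e.symm b, by simp⟩
      · rintro ⟨a, rfl⟩
        exact ⟨e a, by simp⟩
  · intro f _ _ φ hφ
    have : ∀ ω, ∑' ι : PEmpty ↪ ℕ, (∏ a, (f a (w (ι a) ω) : ℝ≥0∞)) *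
        expNeg (tailSum (range ι) φ (fun j => w j ω))
        = expNeg (∫⁻ x, φ x ∂(Measure.sum fun j => Measure.dirac (w j ω))) := by
      intro ω
      rw [tsum_eq_single (default : PEmpty ↪ ℕ) (fun b hb => (hb (Subsingleton.elim _ _)).elim),
        lintegral_sum_measure]
      simp_rw [lintegral_dirac' _ hφ.coe_nnreal_ennreal]
      simp [tailSum]
    simp_rw [this]
    rw [hN.laplace hφ.coe_nnreal_ennreal]
    simp
  · intro α _ ih f hf hfin φ hφ
    have : Countable (α ↪ ℕ) := DFunLike.coe_injective.countable
    -- The factor `e^{φ}` compensates the `e^{-φ}` of the new point, which still belongs to the tail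
    -- before it is chosen.
    let g : S → ℝ≥0 := fun x => f none x * Real.toNNReal (Real.exp (φ x))
    have hg : Measurable g := by
      have := hf none
      fun_prop
    have hgf : ∀ x, expNeg (φ x) * g x = f none x := by
      intro x
      rw [expNeg_coe, ENNReal.coe_mul, mul_left_comm]
      change (f none x : ℝ≥0∞) * (_ * ENNReal.ofReal _) = _
      rw [← ENNReal.ofReal_mul (Real.exp_pos _).le, ← Real.exp_add]
      simp
    set C := ∏ a : α, ∫⁻ x, f (some a) x ∂ν with hC
    have hCtop : C ≠ ∞ := ENNReal.prod_ne_top fun a _ => hfin _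
    set F := ∫⁻ x, f none x ∂ν with hF
    set I : ℝ≥0∞ := ∫⁻ x, (1 - expNeg (φ x)) ∂ν with hI
    -- The increment of the exponent `I` when `φ` is replaced by `φ + 2⁻ⁿ g`.
    let K : ℕ → ℝ≥0∞ := fun n => ∫⁻ x, expNeg (φ x) *
      (1 - expNeg (((2 : ℝ≥0)⁻¹ ^ n : ℝ≥0) * (g x : ℝ≥0∞))) ∂ν
    let A : (α ↪ ℕ) → Ω → ℝ≥0∞ := fun ι ω => (∏ a, (f (some a) (w (ι a) ω) : ℝ≥0∞)) *
        expNeg (tailSum (range ι) φ (fun j => w j ω))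
    have hAmeas : ∀ ι, Measurable (A ι) := by
      intro ι
      have h1 := measurable_tailSum hw (range ι) hφ
      refine Measurable.mul (Finset.measurable_prod _ fun a _ => ?_) (measurable_expNeg.comp h1)
      exact ((hf _).comp (hw _)).coe_nnreal_ennreal
    have hgmeas : ∀ ι : α ↪ ℕ, Measurable fun ω => tailSum (range ι) g (fun j => w j ω) :=
      fun ι => measurable_tailSum hw _ hg
    -- the increments of the functional in the direction `g`
    have hinc : ∀ n, ∫⁻ ω, ∑' ι : α ↪ ℕ, A ι ω *
        dyadicQuot n (tailSum (range ι) g (fun j => w j ω)) ∂P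
        = C * expNeg I * (2 ^ n * (1 - expNeg (K n))) := by
      intro n
      set t : ℝ≥0 := (2 : ℝ≥0)⁻¹ ^ n with ht
      have h0 := ih (fun a => f (some a)) (fun a => hf _) (fun a => hfin _) φ hφ
      have h1 := ih (fun a => f (some a)) (fun a => hf _) (fun a => hfin _)
        (fun y => φ y + t * g y) (by fun_prop)
      have h2 : ∫⁻ x, (1 - expNeg ((φ x + t * g x : ℝ≥0) : ℝ≥0∞)) ∂ν = I + K n := by
        rw [hI, ← lintegral_add_left (by fun_prop)]
        refine lintegral_congr fun x => ?_
        rw [ENNReal.coe_add, ENNReal.coe_mul, expNeg_add]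
        have hu := expNeg_le_one (φ x)
        have hv := expNeg_le_one (t * g x)
        generalize expNeg (φ x) = u at *
        generalize expNeg (t * g x) = v at *
        have huv : u * v ≤ 1 := mul_le_one' hu hv
        have hutop : u * v ≠ ∞ := ne_top_of_le_ne_top ENNReal.one_ne_top huv
        refine ENNReal.sub_eq_of_eq_add hutop ?_
        rw [add_assoc, ← mul_add, tsub_add_cancel_of_le hv, mul_one, tsub_add_cancel_of_le hu]
      rw [h2, expNeg_add] at h1
      -- The difference is first written as a sum, as subtraction in `[0, ∞]` is truncated; both
      -- terms with a closed form are finite, so one can be cancelled afterwards.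
      have h3 : ∫⁻ ω, ∑' ι : α ↪ ℕ, A ι ω ∂P
          = ∫⁻ ω, ∑' ι : α ↪ ℕ, (∏ a, (f (some a) (w (ι a) ω) : ℝ≥0∞)) *
              expNeg (tailSum (range ι) (fun y => φ y + t * g y) (fun j => w j ω)) ∂P
            + ∫⁻ ω, ∑' ι : α ↪ ℕ, A ι ω *
              (1 - expNeg (t * tailSum (range ι) g (fun j => w j ω))) ∂P := by
        rw [← lintegral_add_right]
        · refine lintegral_congr fun ω => ?_
          rw [← ENNReal.tsum_add]
          refine tsum_congr fun ι => ?_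
          simp only [A]
          rw [tailSum_add_smul, expNeg_add, ← mul_assoc, ← mul_add, add_comm,
            tsub_add_cancel_of_le (expNeg_le_one _), mul_one]
        · refine Measurable.tsum fun ι => ?_
          have := hAmeas ι
          have := hgmeas ι
          fun_prop
      change ∫⁻ ω, ∑' ι : α ↪ ℕ, A ι ω ∂P = _ at h0
      rw [h0, h1] at h3
      have h4 : ∫⁻ ω, ∑' ι : α ↪ ℕ, A ι ω *
              (1 - expNeg (t * tailSum (range ι) g (fun j => w j ω))) ∂P
          = C * expNeg I * (1 - expNeg (K n)) := by
        rw [ENNReal.mul_sub (fun _ _ => ENNReal.mul_ne_top hCtop (expNeg_ne_top _)), mul_one]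
        refine ENNReal.eq_sub_of_add_eq ?_ ?_
        · exact ENNReal.mul_ne_top (ENNReal.mul_ne_top hCtop (expNeg_ne_top _)) (expNeg_ne_top _)
        · rw [add_comm, mul_assoc]
          exact h3.symm
      rw [mul_left_comm, ← h4, ← lintegral_const_mul']
      · refine lintegral_congr fun ω => ?_
        rw [← ENNReal.tsum_mul_left]
        refine tsum_congr fun ι => ?_
        rw [dyadicQuot, mul_left_comm]
      · simp
    have hleft : Filter.Tendsto (fun n => ∫⁻ ω, ∑' ι : α ↪ ℕ, A ι ω *
        dyadicQuot n (tailSum (range ι) g (fun j => w j ω)) ∂P) Filter.atTop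
        (nhds (∫⁻ ω, ∑' ι : α ↪ ℕ, A ι ω * tailSum (range ι) g (fun j => w j ω) ∂P)) := by
      have hmono : ∀ ω, ∀ ι : α ↪ ℕ, Monotone fun n => A ι ω *
          dyadicQuot n (tailSum (range ι) g (fun j => w j ω)) := fun ω ι n k hnk =>
        mul_le_mul_right (monotone_dyadicQuot _ hnk) _
      have hAtop : ∀ ι ω, A ι ω ≠ ∞ := fun ι ω =>
        ENNReal.mul_ne_top (ENNReal.prod_ne_top fun a _ => ENNReal.coe_ne_top) (expNeg_ne_top _)
      refine lintegral_tendsto_of_tendsto_of_monotone (fun n => ?_) (ae_of_all _ fun ω n k hnk => ?_)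
        (ae_of_all _ fun ω => ?_)
      · refine (Measurable.tsum fun ι => ?_).aemeasurable
        have := hAmeas ι
        have := hgmeas ι
        fun_prop
      · exact ENNReal.tsum_le_tsum fun ι => hmono ω ι hnk
      · refine tendsto_tsum_of_monotone (hmono ω) fun ι => ?_
        exact ENNReal.Tendsto.const_mul (tendsto_dyadicQuot _) (Or.inr (hAtop ι ω))
    have hK : Filter.Tendsto (fun n => 2 ^ n * K n) Filter.atTop (nhds F) := by
      have h1 : ∀ n, 2 ^ n * K n = ∫⁻ x, expNeg (φ x) * dyadicQuot n (g x) ∂ν := by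
        intro n
        rw [← lintegral_const_mul' _ _ (by simp)]
        refine lintegral_congr fun x => ?_
        rw [dyadicQuot, mul_left_comm]
      simp_rw [h1, hF, ← hgf]
      refine lintegral_tendsto_of_tendsto_of_monotone (fun n => ?_)
        (ae_of_all _ fun x n k hnk => mul_le_mul_right (monotone_dyadicQuot _ hnk) _)
        (ae_of_all _ fun x => ENNReal.Tendsto.const_mul (tendsto_dyadicQuot _)
          (Or.inr (expNeg_ne_top _)))
      fun_prop
    have hK0 : Filter.Tendsto K Filter.atTop (nhds 0) := by
      have h1 : ∀ n, (((2 : ℝ≥0)⁻¹ ^ n : ℝ≥0) : ℝ≥0∞) * (2 ^ n * K n) = K n := fun n => by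
        rw [← mul_assoc, mul_comm _ (2 ^ n), two_pow_mul_half_pow, one_mul]
      have := ENNReal.Tendsto.mul tendsto_half_pow (Or.inr (hfin none)) hK (Or.inr (by simp))
      simpa only [h1, zero_mul] using this
    have hright : Filter.Tendsto (fun n => C * expNeg I * (2 ^ n * (1 - expNeg (K n))))
        Filter.atTop (nhds (C * expNeg I * F)) :=
      ENNReal.Tendsto.const_mul (tendsto_mul_one_sub_expNeg hK0 hK)
        (Or.inr (ENNReal.mul_ne_top hCtop (expNeg_ne_top _)))
    simp_rw [hinc] at hleft
    have key := tendsto_nhds_unique hleft hright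
    rw [Fintype.prod_option, ← hF, ← hC, mul_assoc, mul_comm, ← key]
    refine lintegral_congr fun ω => ?_
    -- An embedding of `Option α` is an embedding of `α` with one more label outside its range; the
    -- sum over that label is the tail sum of `g`.
    rw [← (Function.Embedding.optionEmbeddingEquiv α ℕ).symm.tsum_eq, ENNReal.tsum_sigma']
    refine tsum_congr fun ι => ?_
    have h5 : tailSum (range ι) g (fun j => w j ω)
        = ∑' j : ↥(range ι)ᶜ, (g (w j ω) : ℝ≥0∞) := by
      exact (tsum_subtype (range ι)ᶜ fun j => (g (w j ω) : ℝ≥0∞)).symm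
    rw [h5, ← ENNReal.tsum_mul_left]
    refine tsum_congr fun j => ?_
    have h6 : range ((Function.Embedding.optionEmbeddingEquiv α ℕ).symm ⟨ι, j⟩)
        = insert (j : ℕ) (range ι) := by
      ext k
      simp [Option.exists, eq_comm]
    rw [h6, Fintype.prod_option]
    simp only [A]
    rw [tailSum_eq_add_insert (s := range ι) j.2, expNeg_add]
    simp only [Function.Embedding.optionEmbeddingEquiv_symm_apply,
      Function.Embedding.optionElim_apply, Option.elim'_none, Option.elim'_some]
    rw [← hgf]
    ring

end Palm

/-! ### Integrability against the Lévy measure -/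

/-- Bernoulli's inequality for `(1 + s)^p` with `s = e^{-w} - 1` and `p = max z 1`; the maximum
ensures `p ≥ 1`, and raising `z` to `p` only increases the left side. -/
lemma one_sub_exp_neg_mul_le {z w : ℝ} (hw : 0 ≤ w) :
    1 - Real.exp (-z * w) ≤ max z 1 * (1 - Real.exp (-w)) := by
  have h0 : 0 ≤ 1 - Real.exp (-w) := by
    have : Real.exp (-w) ≤ 1 := Real.exp_le_one_iff.2 (by linarith)
    linarith
  have h1 : 1 - Real.exp (-z * w) ≤ 1 - Real.exp (-(max z 1) * w) := by
    have : Real.exp (-(max z 1) * w) ≤ Real.exp (-z * w) := by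
      apply Real.exp_le_exp.2
      nlinarith [le_max_left z 1]
    linarith
  have h2 := one_add_mul_self_le_rpow_one_add (s := Real.exp (-w) - 1) (p := max z 1)
    (by linarith [Real.exp_pos (-w)]) (le_max_right _ _)
  rw [add_sub_cancel, ← Real.exp_mul] at h2
  rw [show -(max z 1) * w = -w * max z 1 by ring] at h1
  linarith

/-- One factor `w` is traded for `(1 + w)(1 - e^{-w})`, which leaves the powers `n - 1` and `n`;
each is bounded through `(zw)^k / k! ≤ e^{zw}`. -/
lemma pow_mul_exp_neg_le {n : ℕ} {z w : ℝ} (hn : 1 ≤ n) (hz : 0 < z) (hw : 0 ≤ w) :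
    w ^ n * Real.exp (-z * w) ≤
      ((n - 1).factorial / z ^ (n - 1) + n.factorial / z ^ n) * (1 - Real.exp (-w)) := by
  have hpow : ∀ k : ℕ, w ^ k * Real.exp (-z * w) ≤ k.factorial / z ^ k := by
    intro k
    have h1 := Real.pow_div_factorial_le_exp (z * w) (by positivity) k
    have h2 : Real.exp (z * w) * Real.exp (-z * w) = 1 := by
      rw [← Real.exp_add]; simp
    rw [div_le_iff₀ (by positivity)] at h1
    rw [le_div_iff₀ (by positivity)]
    calc w ^ k * Real.exp (-z * w) * z ^ k = (z * w) ^ k * Real.exp (-z * w) := by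
          rw [mul_pow]; ring
      _ ≤ (Real.exp (z * w) * k.factorial) * Real.exp (-z * w) := by gcongr
      _ = k.factorial := by rw [mul_right_comm, h2, one_mul]
  have h3 : w ≤ (1 + w) * (1 - Real.exp (-w)) := by
    have h1 := Real.add_one_le_exp w
    have h2 : Real.exp (-w) * Real.exp w = 1 := by rw [← Real.exp_add]; simp
    nlinarith [Real.exp_pos (-w)]
  have h0 : 0 ≤ 1 - Real.exp (-w) := by
    have : Real.exp (-w) ≤ 1 := Real.exp_le_one_iff.2 (by linarith)
    linarith
  obtain ⟨k, rfl⟩ : ∃ k, n = k + 1 := ⟨n - 1, by omega⟩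
  simp only [Nat.add_sub_cancel]
  calc w ^ (k + 1) * Real.exp (-z * w) = w ^ k * Real.exp (-z * w) * w := by ring
    _ ≤ w ^ k * Real.exp (-z * w) * ((1 + w) * (1 - Real.exp (-w))) := by gcongr
    _ = (w ^ k * Real.exp (-z * w) + w ^ (k + 1) * Real.exp (-z * w)) * (1 - Real.exp (-w)) := by
        ring
    _ ≤ _ := by gcongr <;> exact hpow _

section Levy

variable {lam : ℝ → ℝ≥0}

instance sigmaFinite_levyMeasure : SigmaFinite (levyMeasure lam) := by
  unfold levyMeasure
  exact SigmaFinite.withDensity lam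

lemma lintegral_levyMeasure (hlam : Measurable lam) {f : ℝ → ℝ≥0∞} (hf : Measurable f) :
    ∫⁻ w, f w ∂(levyMeasure lam) = ∫⁻ w in Ioi 0, f w * lam w := by
  rw [levyMeasure, lintegral_withDensity_eq_lintegral_mul _ hlam.coe_nnreal_ennreal hf]
  simp [mul_comm]

lemma levyMeasure_Iic_zero : levyMeasure lam (Iic 0) = 0 := by
  rw [levyMeasure]
  refine (withDensity_absolutelyContinuous _ _) ?_
  rw [Measure.restrict_apply measurableSet_Iic, Iic_inter_Ioi, Ioc_self, measure_empty]

lemma integrableOn_one_sub_exp (hlam : Measurable lam)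
    (hfin : ∫⁻ w in Ioi (0 : ℝ), ENNReal.ofReal (1 - Real.exp (-w)) * (lam w : ℝ≥0∞) < ∞) :
    IntegrableOn (fun w : ℝ => (1 - Real.exp (-w)) * (lam w : ℝ)) (Ioi 0) := by
  refine ⟨by fun_prop, ?_⟩
  rw [hasFiniteIntegral_iff_ofReal]
  · refine lt_of_eq_of_lt (setLIntegral_congr_fun measurableSet_Ioi fun w hw => ?_) hfin
    rw [ENNReal.ofReal_mul' (lam w).coe_nonneg, ENNReal.ofReal_coe_nnreal]
  · filter_upwards [ae_restrict_mem measurableSet_Ioi] with w hw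
    have : Real.exp (-w) ≤ 1 := Real.exp_le_one_iff.2 (by linarith [show 0 < w from hw])
    exact mul_nonneg (by linarith) (lam w).coe_nonneg

lemma integrableOn_of_le_one_sub_exp (hlam : Measurable lam)
    (hfin : ∫⁻ w in Ioi (0 : ℝ), ENNReal.ofReal (1 - Real.exp (-w)) * (lam w : ℝ≥0∞) < ∞)
    {f : ℝ → ℝ} (hf : Measurable f) (C : ℝ) (hf0 : ∀ w, 0 < w → 0 ≤ f w)
    (hfC : ∀ w, 0 < w → f w ≤ C * (1 - Real.exp (-w))) :
    IntegrableOn (fun w : ℝ => f w * (lam w : ℝ)) (Ioi 0) := by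
  refine Integrable.mono' ((integrableOn_one_sub_exp hlam hfin).const_mul C) (by fun_prop) ?_
  filter_upwards [ae_restrict_mem measurableSet_Ioi] with w hw
  rw [Real.norm_of_nonneg (mul_nonneg (hf0 w hw) (lam w).coe_nonneg), ← mul_assoc]
  exact mul_le_mul_of_nonneg_right (hfC w hw) (lam w).coe_nonneg

lemma integrableOn_psi (hlam : Measurable lam)
    (hfin : ∫⁻ w in Ioi (0 : ℝ), ENNReal.ofReal (1 - Real.exp (-w)) * (lam w : ℝ≥0∞) < ∞)
    {z : ℝ} (hz : 0 ≤ z) :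
    IntegrableOn (fun w : ℝ => (1 - Real.exp (-z * w)) * (lam w : ℝ)) (Ioi 0) :=
  integrableOn_of_le_one_sub_exp hlam hfin (by fun_prop) (max z 1)
    (fun w hw => sub_nonneg.2 (Real.exp_le_one_iff.2 (by nlinarith)))
    (fun w hw => one_sub_exp_neg_mul_le hw.le)

lemma integrableOn_kappa (hlam : Measurable lam)
    (hfin : ∫⁻ w in Ioi (0 : ℝ), ENNReal.ofReal (1 - Real.exp (-w)) * (lam w : ℝ≥0∞) < ∞)
    {n : ℕ} {z : ℝ} (hn : 1 ≤ n) (hz : 0 < z) :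
    IntegrableOn (fun w : ℝ => w ^ n * Real.exp (-z * w) * (lam w : ℝ)) (Ioi 0) :=
  integrableOn_of_le_one_sub_exp hlam hfin (by fun_prop) _ (fun w hw => by positivity)
    (fun w hw => pow_mul_exp_neg_le hn hz hw.le)

lemma lintegral_levyMeasure_ofReal (hlam : Measurable lam) {f : ℝ → ℝ} (hf : Measurable f)
    (hf0 : ∀ w, 0 < w → 0 ≤ f w)
    (hint : IntegrableOn (fun w : ℝ => f w * (lam w : ℝ)) (Ioi 0)) :
    ∫⁻ w, ENNReal.ofReal (f w) ∂(levyMeasure lam)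
      = ENNReal.ofReal (∫ w in Ioi 0, f w * (lam w : ℝ)) := by
  rw [lintegral_levyMeasure hlam (by fun_prop), ofReal_integral_eq_lintegral_ofReal hint]
  · refine lintegral_congr fun w => ?_
    rw [ENNReal.ofReal_mul' (lam w).coe_nonneg, ENNReal.ofReal_coe_nnreal]
  · filter_upwards [ae_restrict_mem measurableSet_Ioi] with w hw
    exact mul_nonneg (hf0 w hw) (lam w).coe_nonneg

lemma lintegral_levyMeasure_kappa (hlam : Measurable lam)
    (hfin : ∫⁻ w in Ioi (0 : ℝ), ENNReal.ofReal (1 - Real.exp (-w)) * (lam w : ℝ≥0∞) < ∞)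
    {n : ℕ} {z : ℝ} (hn : 1 ≤ n) (hz : 0 < z) :
    ∫⁻ w, ENNReal.ofReal (w ^ n * Real.exp (-z * w)) ∂(levyMeasure lam)
      = ENNReal.ofReal (kappa lam n z) :=
  lintegral_levyMeasure_ofReal hlam (by fun_prop) (fun w hw => by positivity)
    (integrableOn_kappa hlam hfin hn hz)

lemma ae_levyMeasure_pos : ∀ᵐ w ∂(levyMeasure lam), 0 < w := by
  have : {w : ℝ | ¬ 0 < w} = Iic 0 := by ext; simp
  rw [ae_iff, this, levyMeasure_Iic_zero]

lemma lintegral_levyMeasure_psi (hlam : Measurable lam)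
    (hfin : ∫⁻ w in Ioi (0 : ℝ), ENNReal.ofReal (1 - Real.exp (-w)) * (lam w : ℝ≥0∞) < ∞)
    {z : ℝ} (hz : 0 ≤ z) :
    ∫⁻ w, (1 - expNeg (ENNReal.ofReal z * ENNReal.ofReal w)) ∂(levyMeasure lam)
      = ENNReal.ofReal (psi lam z) := by
  have h := lintegral_levyMeasure_ofReal (f := fun w => 1 - Real.exp (-z * w)) hlam (by fun_prop)
    (fun w hw => sub_nonneg.2 (Real.exp_le_one_iff.2 (by nlinarith)))
    (integrableOn_psi hlam hfin hz)
  rw [psi, ← h]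
  refine lintegral_congr_ae ?_
  filter_upwards [ae_levyMeasure_pos] with w hw
  rw [← ENNReal.ofReal_mul hz, expNeg_ofReal (mul_nonneg hz hw.le),
    ENNReal.ofReal_sub _ (Real.exp_pos _).le, ENNReal.ofReal_one, neg_mul]

lemma psi_nonneg {z : ℝ} (hz : 0 ≤ z) : 0 ≤ psi lam z :=
  setIntegral_nonneg measurableSet_Ioi fun w hw => mul_nonneg
    (sub_nonneg.2 (Real.exp_le_one_iff.2 (by nlinarith [show 0 < w from hw]))) (lam w).coe_nonneg

lemma kappa_nonneg (n : ℕ) (z : ℝ) : 0 ≤ kappa lam n z :=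
  setIntegral_nonneg measurableSet_Ioi fun w (hw : 0 < w) => by positivity

end Levy

/-! ### The masses of a completely random measure -/

section Masses

variable {Ω : Type*} [MeasurableSpace Ω] {P : Measure Ω} {lam : ℝ → ℝ≥0} {w : ℕ → Ω → ℝ}

lemma IsPoissonProcess.ae_eq_zero {S : Type*} [MeasurableSpace S] {ν : Measure S}
    [IsProbabilityMeasure P] {N : Ω → Measure S} (hN : IsPoissonProcess P ν N) {B : Set S}
    (hB : MeasurableSet B) (hν : ν B = 0) : ∀ᵐ ω ∂P, N ω B = 0 := by
  have hNB : Measurable fun ω => N ω B := (Measure.measurable_coe hB).comp hN.measurable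
  have h := hN.map_eq B hB (by simp [hν])
  have h1 : ∀ᵐ x ∂(P.map fun ω => N ω B), x = 0 := by
    rw [h, ae_map_iff (p := (· = 0)) .of_discrete (measurableSet_singleton 0), hν]
    simp only [ENNReal.toNNReal_zero]
    refine (mem_ae_iff_prob_eq_one .of_discrete).2 ?_
    have : {n : ℕ | (n : ℝ≥0∞) ∈ ({0} : Set ℝ≥0∞)} = {0} := by ext; simp
    simp [poissonMeasure_singleton]
  exact ae_of_ae_map hNB.aemeasurable h1

lemma IsPoissonProcess.ae_masses_pos [IsProbabilityMeasure P]
    (hN : IsPoissonProcess P (levyMeasure lam)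
      (fun ω => Measure.sum fun j => Measure.dirac (w j ω))) :
    ∀ᵐ ω ∂P, ∀ j, 0 < w j ω := by
  filter_upwards [hN.ae_eq_zero measurableSet_Iic levyMeasure_Iic_zero] with ω hω j
  rw [Measure.sum_apply _ measurableSet_Iic, ENNReal.tsum_eq_zero] at hω
  have := hω j
  rw [Measure.dirac_apply' _ measurableSet_Iic] at this
  by_contra hj
  rw [indicator_of_mem (by simpa using hj)] at this
  simp at this

lemma IsPoissonProcess.laplace_masses [IsProbabilityMeasure P] (hlam : Measurable lam)
    (hfin : ∫⁻ w in Ioi (0 : ℝ), ENNReal.ofReal (1 - Real.exp (-w)) * (lam w : ℝ≥0∞) < ∞)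
    (hN : IsPoissonProcess P (levyMeasure lam)
      (fun ω => Measure.sum fun j => Measure.dirac (w j ω))) {z : ℝ} (hz : 0 ≤ z) :
    ∫⁻ ω, expNeg (ENNReal.ofReal z * ∑' j, ENNReal.ofReal (w j ω)) ∂P
      = ENNReal.ofReal (Real.exp (-psi lam z)) := by
  have h := hN.laplace (φ := fun w => ENNReal.ofReal z * ENNReal.ofReal w) (by fun_prop)
  rw [lintegral_levyMeasure_psi hlam hfin hz, expNeg_ofReal (psi_nonneg hz)] at h
  rw [← h]
  refine lintegral_congr fun ω => ?_
  rw [lintegral_sum_measure, ← ENNReal.tsum_mul_left]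
  congr 1
  refine tsum_congr fun j => ?_
  rw [lintegral_dirac' _ (by fun_prop)]

lemma tendsto_psi_zero (hlam : Measurable lam)
    (hfin : ∫⁻ w in Ioi (0 : ℝ), ENNReal.ofReal (1 - Real.exp (-w)) * (lam w : ℝ≥0∞) < ∞) :
    Filter.Tendsto (fun n : ℕ => psi lam (2⁻¹ ^ n)) Filter.atTop (nhds 0) := by
  have h : Filter.Tendsto (fun n : ℕ => psi lam (2⁻¹ ^ n)) Filter.atTop
      (nhds (∫ w in Ioi (0 : ℝ), (0 : ℝ))) := by
    refine tendsto_integral_of_dominated_convergence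
      (fun w => (1 - Real.exp (-w)) * (lam w : ℝ)) (fun n => by fun_prop)
      (integrableOn_one_sub_exp hlam hfin) (fun n => ?_) ?_
    · filter_upwards [ae_restrict_mem measurableSet_Ioi] with w (hw : 0 < w)
      have h1 : (2⁻¹ : ℝ) ^ n ≤ 1 := pow_le_one₀ (by norm_num) (by norm_num)
      have h2 : (0 : ℝ) ≤ 2⁻¹ ^ n := by positivity
      rw [Real.norm_of_nonneg (mul_nonneg (sub_nonneg.2 (Real.exp_le_one_iff.2 (by nlinarith)))
        (lam w).coe_nonneg)]
      have h3 : Real.exp (-w) ≤ Real.exp (-2⁻¹ ^ n * w) := Real.exp_le_exp.2 (by nlinarith)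
      gcongr
    · filter_upwards with w
      have h1 : Filter.Tendsto (fun n : ℕ => (2⁻¹ : ℝ) ^ n) Filter.atTop (nhds 0) :=
        tendsto_pow_atTop_nhds_zero_of_lt_one (by norm_num) (by norm_num)
      have h2 : Continuous fun t : ℝ => (1 - Real.exp (-t * w)) * (lam w : ℝ) := by fun_prop
      simpa [Function.comp_def] using (h2.tendsto 0).comp h1
  simpa using h

/-- As `z` decreases to `0`, `E[e^{-zT}]` tends to `P(T < ∞)`, since `e^{-zT}` vanishes for every `z
> 0` where `T = ∞`; and `e^{-ψ(z)}` tends to `1`. -/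
lemma IsPoissonProcess.ae_sum_masses_lt_top [IsProbabilityMeasure P] (hlam : Measurable lam)
    (hfin : ∫⁻ w in Ioi (0 : ℝ), ENNReal.ofReal (1 - Real.exp (-w)) * (lam w : ℝ≥0∞) < ∞)
    (hw : ∀ j, Measurable (w j))
    (hN : IsPoissonProcess P (levyMeasure lam)
      (fun ω => Measure.sum fun j => Measure.dirac (w j ω))) :
    ∀ᵐ ω ∂P, ∑' j, ENNReal.ofReal (w j ω) < ∞ := by
  set T : Ω → ℝ≥0∞ := fun ω => ∑' j, ENNReal.ofReal (w j ω) with hT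
  have hTm : Measurable T := Measurable.tsum fun j => by have := hw j; fun_prop
  have hTs : MeasurableSet {ω | T ω < ∞} := measurableSet_lt hTm measurable_const
  have h1 : Filter.Tendsto (fun n : ℕ => ∫⁻ ω, expNeg (ENNReal.ofReal (2⁻¹ ^ n) * T ω) ∂P)
      Filter.atTop (nhds (∫⁻ ω, {ω | T ω < ∞}.indicator 1 ω ∂P)) := by
    refine tendsto_lintegral_of_dominated_convergence (fun _ => 1) (fun n => by fun_prop)
      (fun n => ae_of_all _ fun ω => expNeg_le_one _) (by simp) (ae_of_all _ fun ω => ?_)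
    by_cases hω : T ω < ∞
    · rw [indicator_of_mem (by exact hω)]
      have h2 : Filter.Tendsto (fun n : ℕ => ENNReal.ofReal ((2⁻¹ : ℝ) ^ n)) Filter.atTop
          (nhds 0) := by
        rw [← ENNReal.ofReal_zero]
        exact (ENNReal.continuous_ofReal.tendsto 0).comp
          (tendsto_pow_atTop_nhds_zero_of_lt_one (by norm_num) (by norm_num))
      have h3 := (continuous_expNeg.tendsto _).comp (ENNReal.Tendsto.mul_const h2 (Or.inr hω.ne))
      simpa [Function.comp_def] using h3
    · rw [indicator_of_notMem (by exact hω)]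
      have hω' : T ω = ∞ := by simpa using hω
      have : ∀ n : ℕ, expNeg (ENNReal.ofReal (2⁻¹ ^ n) * T ω) = 0 := fun n => by
        rw [hω', ENNReal.mul_top (by simp), expNeg_top]
      simp_rw [this]
      exact tendsto_const_nhds
  have h2 : ∀ n : ℕ, ∫⁻ ω, expNeg (ENNReal.ofReal (2⁻¹ ^ n) * T ω) ∂P
      = ENNReal.ofReal (Real.exp (-psi lam (2⁻¹ ^ n))) := fun n =>
    hN.laplace_masses hlam hfin (by positivity)
  simp_rw [h2] at h1
  have h3 : Filter.Tendsto (fun n : ℕ => ENNReal.ofReal (Real.exp (-psi lam (2⁻¹ ^ n))))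
      Filter.atTop (nhds 1) := by
    have hc : Continuous fun t : ℝ => ENNReal.ofReal (Real.exp (-t)) :=
      ENNReal.continuous_ofReal.comp (by fun_prop)
    simpa [Function.comp_def] using (hc.tendsto 0).comp (tendsto_psi_zero hlam hfin)
  have h4 := tendsto_nhds_unique h1 h3
  rw [lintegral_indicator_one hTs] at h4
  exact (mem_ae_iff_prob_eq_one hTs).2 h4

lemma IsPoissonProcess.neg_log_laplace [IsProbabilityMeasure P] (hlam : Measurable lam)
    (hfin : ∫⁻ w in Ioi (0 : ℝ), ENNReal.ofReal (1 - Real.exp (-w)) * (lam w : ℝ≥0∞) < ∞)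
    (hw : ∀ j, Measurable (w j))
    (hN : IsPoissonProcess P (levyMeasure lam)
      (fun ω => Measure.sum fun j => Measure.dirac (w j ω))) {z : ℝ} (hz : 0 ≤ z) :
    -Real.log (∫ ω, Real.exp (-z * (∑' j, ENNReal.ofReal (w j ω)).toReal) ∂P) = psi lam z := by
  have hTm : Measurable fun ω => ∑' j, ENNReal.ofReal (w j ω) :=
    Measurable.tsum fun j => by have := hw j; fun_prop
  rw [integral_eq_lintegral_of_nonneg_ae (ae_of_all _ fun ω => (Real.exp_pos _).le)
    (Measurable.aestronglyMeasurable (by fun_prop))]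
  have h : ∫⁻ ω, ENNReal.ofReal (Real.exp (-z * (∑' j, ENNReal.ofReal (w j ω)).toReal)) ∂P
      = ∫⁻ ω, expNeg (ENNReal.ofReal z * ∑' j, ENNReal.ofReal (w j ω)) ∂P := by
    refine lintegral_congr_ae ?_
    filter_upwards [hN.ae_sum_masses_lt_top hlam hfin hw] with ω hω
    rw [expNeg_of_ne_top (ENNReal.mul_ne_top (by simp) hω.ne), ENNReal.toReal_mul,
      ENNReal.toReal_ofReal hz, neg_mul]
  rw [h, hN.laplace_masses hlam hfin hz, ENNReal.toReal_ofReal (Real.exp_pos _).le, Real.log_exp,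
    neg_neg]

end Masses

/-! ### Products of atomic measures -/

lemma prod_tsum_eq_tsum_prod {κ : Type*} : ∀ {n : ℕ} (f : Fin n → κ → ℝ≥0∞),
    ∏ i, ∑' k, f i k = ∑' J : Fin n → κ, ∏ i, f i (J i) := by
  intro n
  induction n with
  | zero => intro f; simp
  | succ n ih =>
    intro f
    rw [Fin.prod_univ_succ, ih, ← (Fin.consEquiv fun _ => κ).tsum_eq, ENNReal.tsum_prod',
      ← ENNReal.tsum_mul_right]
    refine tsum_congr fun k => ?_
    rw [← ENNReal.tsum_mul_left]
    refine tsum_congr fun J => ?_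
    simp [Fin.consEquiv, Fin.prod_univ_succ]

lemma pi_sum_smul_dirac {κ E : Type*} [Countable κ] [MeasurableSpace E] {n : ℕ}
    (c : Fin n → κ → ℝ≥0∞) (x : Fin n → κ → E)
    [∀ i, SigmaFinite (Measure.sum fun k => c i k • Measure.dirac (x i k))] :
    Measure.pi (fun i => Measure.sum fun k => c i k • Measure.dirac (x i k))
      = Measure.sum fun J : Fin n → κ =>
          (∏ i, c i (J i)) • Measure.dirac (fun i => x i (J i)) := by
  classical
  refine Measure.pi_eq fun s hs => ?_
  rw [Measure.sum_apply _ (MeasurableSet.univ_pi hs)]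
  simp_rw [Measure.sum_apply _ (hs _)]
  rw [prod_tsum_eq_tsum_prod]
  refine tsum_congr fun J => ?_
  rw [Measure.smul_apply, Measure.dirac_apply' _ (MeasurableSet.univ_pi hs), smul_eq_mul]
  simp_rw [Measure.smul_apply, Measure.dirac_apply' _ (hs _), smul_eq_mul]
  rw [Finset.prod_mul_distrib]
  congr 1
  by_cases h : ∀ i, x i (J i) ∈ s i
  · rw [indicator_of_mem (by simpa using h)]
    simp [h]
  · rw [indicator_of_notMem (by simpa using h)]
    push Not at h
    obtain ⟨i, hi⟩ := h
    exact (Finset.prod_eq_zero (Finset.mem_univ i) (by simp [hi])).symm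

lemma lintegral_pi_prod {E : Type*} [MeasurableSpace E] : ∀ {n : ℕ} (μ : Fin n → Measure E)
    [∀ i, SigmaFinite (μ i)] (f : Fin n → E → ℝ≥0∞), (∀ i, Measurable (f i)) →
    ∫⁻ x, ∏ i, f i (x i) ∂(Measure.pi μ) = ∏ i, ∫⁻ x, f i x ∂(μ i) := by
  intro n
  induction n with
  | zero => intro μ _ f _; simp
  | succ n ih =>
    intro μ _ f hf
    have hmp := (measurePreserving_piFinSuccAbove μ 0).symm
    rw [← hmp.lintegral_comp (by fun_prop), Fin.prod_univ_succ]
    simp only [MeasurableEquiv.piFinSuccAbove_symm_apply, Fin.insertNthEquiv, Equiv.coe_fn_mk,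
      Fin.prod_univ_succ, Fin.insertNth_zero, Fin.cons_zero, Fin.cons_succ, Fin.zero_succAbove]
    rw [← ih (fun i => μ i.succ) (fun i => f i.succ) (fun i => hf _)]
    exact lintegral_prod_mul (hf 0).aemeasurable
      (Finset.measurable_prod _ fun i _ => (hf _).comp (measurable_pi_apply i)).aemeasurable

lemma lintegral_pi_prod_fintype {ι E : Type*} [Fintype ι] [MeasurableSpace E] (μ : ι → Measure E)
    [∀ i, SigmaFinite (μ i)] (f : ι → E → ℝ≥0∞) (hf : ∀ i, Measurable (f i)) :
    ∫⁻ x, ∏ i, f i (x i) ∂(Measure.pi μ) = ∏ i, ∫⁻ x, f i x ∂(μ i) := by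
  let e := (Fintype.equivFin ι).symm
  rw [← (measurePreserving_piCongrLeft μ e).lintegral_comp (by fun_prop)]
  simp_rw [← e.prod_comp, MeasurableEquiv.coe_piCongrLeft, Equiv.piCongrLeft_apply_apply]
  exact lintegral_pi_prod (fun i => μ (e i)) (fun i => f (e i)) fun i => hf _

lemma pi_withDensity {ι E : Type*} [Fintype ι] [MeasurableSpace E] (μ : ι → Measure E)
    [∀ i, SigmaFinite (μ i)] (f : ι → E → ℝ≥0∞) (hf : ∀ i, Measurable (f i))
    [∀ i, SigmaFinite ((μ i).withDensity (f i))] :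
    Measure.pi (fun i => (μ i).withDensity (f i))
      = (Measure.pi μ).withDensity fun x => ∏ i, f i (x i) := by
  classical
  refine Measure.pi_eq fun s hs => ?_
  rw [withDensity_apply _ (MeasurableSet.univ_pi hs), Measure.restrict_pi_pi]
  simp_rw [withDensity_apply _ (hs _)]
  exact lintegral_pi_prod_fintype _ f hf

/-! ### Plackett–Luce lists of atoms -/

/-- The mass of the atoms that do not occur before position `i` in the list of labels `J`. -/
def restMass {m : ℕ} (w : ℕ → ℝ) (J : Fin m → ℕ) (i : Fin m) : ℝ≥0∞ :=
  tailSum {k | ∃ j, j < i ∧ J j = k} Real.toNNReal w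

open Classical in
/-- The Plackett–Luce probability of the list of labels `J`. -/
def listWeight {m : ℕ} (w : ℕ → ℝ) (J : Fin m → ℕ) : ℝ≥0∞ :=
  if Function.Injective J then ∏ i, ENNReal.ofReal (w (J i)) * (restMass w J i)⁻¹ else 0

lemma measurableSet_remaining {𝕏 : Type*} [MeasurableSpace 𝕏] [MeasurableSingletonClass 𝕏] {m : ℕ}
    (y : Fin m → 𝕏) (i : Fin m) : MeasurableSet (remaining y i) := by
  have : remaining y i = ⋂ j : Fin m, ⋂ _ : j < i, {y j}ᶜ := by
    ext x; simp [remaining, eq_comm]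
  rw [this]
  exact MeasurableSet.iInter fun j => MeasurableSet.iInter fun _ =>
    (measurableSet_singleton _).compl

section Atomic

variable {𝕏 : Type*} [MeasurableSpace 𝕏] {w : ℕ → ℝ} {x : ℕ → 𝕏} {m : ℕ}

lemma atomicMeasure_univ : atomicMeasure w x univ = ∑' j, ENNReal.ofReal (w j) := by
  simp [atomicMeasure]

lemma atomicMeasure_remaining [MeasurableSingletonClass 𝕏] (hx : Function.Injective x)
    (J : Fin m → ℕ) (i : Fin m) :
    atomicMeasure w x (remaining (fun i => x (J i)) i) = restMass w J i := by
  rw [atomicMeasure, Measure.sum_apply _ (measurableSet_remaining _ _), restMass, tailSum]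
  refine tsum_congr fun k => ?_
  rw [Measure.smul_apply, Measure.dirac_apply' _ (measurableSet_remaining _ _), smul_eq_mul]
  have : x k ∈ remaining (fun i => x (J i)) i ↔ k ∈ {k | ∃ j, j < i ∧ J j = k}ᶜ := by
    simp [remaining, hx.eq_iff]
  by_cases hk : k ∈ {k | ∃ j, j < i ∧ J j = k}ᶜ
  · rw [indicator_of_mem (this.2 hk), indicator_of_mem hk]
    simp [ENNReal.ofReal]
  · rw [indicator_of_notMem (fun h => hk (this.1 h)), indicator_of_notMem hk, mul_zero]

/-- There are infinitely many atoms of positive mass, and `y` removes only finitely many points. -/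
lemma atomicMeasure_remaining_ne_zero [MeasurableSingletonClass 𝕏] (hx : Function.Injective x)
    (hw : ∀ j, 0 < w j) (y : Fin m → 𝕏) (i : Fin m) :
    atomicMeasure w x (remaining y i) ≠ 0 := by
  intro h
  rw [atomicMeasure, Measure.sum_apply _ (measurableSet_remaining _ _),
    ENNReal.tsum_eq_zero] at h
  have hsub : range x ⊆ range y := by
    rintro _ ⟨k, rfl⟩
    have hk := h k
    rw [Measure.smul_apply, Measure.dirac_apply' _ (measurableSet_remaining _ _), smul_eq_mul] at hk
    by_contra hxk
    have : x k ∈ remaining y i := fun j _ hj => hxk ⟨j, hj⟩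
    rw [indicator_of_mem this] at hk
    simp [(hw k).not_ge] at hk
  exact (infinite_range_of_injective hx) ((finite_range y).subset hsub)

lemma dirac_withDensity {E : Type*} [MeasurableSpace E] [MeasurableSingletonClass E] (a : E)
    (f : E → ℝ≥0∞) : (Measure.dirac a).withDensity f = f a • Measure.dirac a := by
  classical
  ext s hs
  rw [withDensity_apply _ hs, setLIntegral_dirac, Measure.smul_apply, Measure.dirac_apply' _ hs]
  by_cases h : a ∈ s <;> simp [h]

open Classical in
lemma plackettLuce_atomicMeasure [MeasurableSingletonClass 𝕏]
    (hx : Function.Injective x) (hfin : ∑' j, ENNReal.ofReal (w j) < ∞) :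
    plackettLuce (atomicMeasure w x) m
      = Measure.sum fun J : Fin m → ℕ => listWeight w J • Measure.dirac (fun i => x (J i)) := by
  have : IsFiniteMeasure (atomicMeasure w x) := ⟨by rwa [atomicMeasure_univ]⟩
  have : SigmaFinite (Measure.sum fun j => ENNReal.ofReal (w j) • Measure.dirac (x j)) :=
    inferInstanceAs (SigmaFinite (atomicMeasure w x))
  have h := pi_sum_smul_dirac (fun (_ : Fin m) j => ENNReal.ofReal (w j)) (fun _ => x)
  have hden : ∀ J : Fin m → ℕ, (if Function.Injective fun i => x (J i) then
      ∏ i, (atomicMeasure w x (remaining (fun i => x (J i)) i))⁻¹ else 0)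
      = if Function.Injective J then ∏ i, (restMass w J i)⁻¹ else 0 := fun J => by
    simp_rw [atomicMeasure_remaining hx]
    exact if_congr (hx.of_comp_iff J) rfl rfl
  rw [plackettLuce]
  conv_lhs => enter [1]; rw [atomicMeasure]
  rw [h, withDensity_sum]
  congr 1
  ext1 J
  rw [withDensity_smul_measure, dirac_withDensity, hden, smul_smul, listWeight]
  split_ifs
  · rw [Finset.prod_mul_distrib]
  · rw [mul_zero]

lemma sigmaFinite_plackettLuce [MeasurableSingletonClass 𝕏] (hx : Function.Injective x)
    (hw : ∀ j, 0 < w j) (hfin : ∑' j, ENNReal.ofReal (w j) < ∞) :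
    SigmaFinite (plackettLuce (atomicMeasure w x) m) := by
  have : IsFiniteMeasure (atomicMeasure w x) := ⟨by rwa [atomicMeasure_univ]⟩
  refine SigmaFinite.withDensity_of_ne_top' fun y => ?_
  split_ifs
  · exact ENNReal.prod_ne_top fun i _ =>
      ENNReal.inv_ne_top.2 (atomicMeasure_remaining_ne_zero hx hw y i)
  · exact ENNReal.zero_ne_top

lemma pi_plackettLuce_atomicMeasure [MeasurableSingletonClass 𝕏] {L : ℕ}
    (hx : Function.Injective x) (hw : ∀ j, 0 < w j) (hfin : ∑' j, ENNReal.ofReal (w j) < ∞) :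
    (Measure.pi fun _ : Fin L => plackettLuce (atomicMeasure w x) m)
      = Measure.sum fun J : Fin L → Fin m → ℕ =>
          (∏ ℓ, listWeight w (J ℓ)) • Measure.dirac (fun ℓ i => x (J ℓ i)) := by
  have hs := sigmaFinite_plackettLuce (m := m) hx hw hfin
  rw [plackettLuce_atomicMeasure hx hfin] at hs ⊢
  exact pi_sum_smul_dirac (fun (_ : Fin L) J => listWeight w J) (fun _ J i => x (J i))

end Atomic

/-! ### Conditional laws -/

section Conditional

variable {Ω 𝕏 : Type*} [mΩ : MeasurableSpace Ω] [MeasurableSpace 𝕏] {P : Measure Ω}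

/-- The defining property of conditional probability in `[0, ∞]`-valued form. The version `q`
inherits integrability from the almost sure equality. -/
lemma measure_inter_eq_setLIntegral_of_condProb [IsProbabilityMeasure P] {m : MeasurableSpace Ω}
    (hm : m ≤ mΩ) {E s : Set Ω} (hE : MeasurableSet[mΩ] E) (hs : MeasurableSet[m] s) {q : Ω → ℝ}
    (hq0 : ∀ ω, 0 ≤ q ω) (hq : P⟦E | m⟧ =ᵐ[P] q) :
    P (s ∩ E) = ∫⁻ ω in s, ENNReal.ofReal (q ω) ∂P := by
  have hint : Integrable q P := integrable_condExp.congr hq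
  have h1 : ∫ ω in s, q ω ∂P = P.real (s ∩ E) := by
    rw [← setIntegral_congr_ae (hm s hs) (hq.mono fun ω h _ => h),
      setIntegral_condExp hm ((integrable_const (1 : ℝ)).indicator hE) hs,
      integral_indicator hE, Measure.restrict_restrict hE, inter_comm]
    simp
  rw [← ofReal_integral_eq_lintegral_ofReal hint.integrableOn (ae_of_all _ hq0), h1,
    ofReal_measureReal]

/-- A nonatomic law gives the measurable diagonal measure zero under `H.prod H`, by Fubini;
countably many pairs are then combined. -/
lemma ae_injective_of_iIndepFun [IsProbabilityMeasure P] [MeasurableEq 𝕏] {H : Measure 𝕏}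
    [IsProbabilityMeasure H] [NullSingletonClass H] {X : ℕ → Ω → 𝕏} (hX : ∀ j, Measurable (X j))
    (hlaw : ∀ j, P.map (X j) = H) (hind : iIndepFun X P) :
    ∀ᵐ ω ∂P, Function.Injective fun j => X j ω := by
  have h : ∀ i j, i ≠ j → ∀ᵐ ω ∂P, X i ω ≠ X j ω := by
    intro i j hij
    have h1 := (indepFun_iff_map_prod_eq_prod_map_map (hX i).aemeasurable (hX j).aemeasurable).1
      (hind.indepFun hij)
    rw [hlaw, hlaw] at h1
    have h2 : (H.prod H) (diagonal 𝕏) = 0 := by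
      rw [Measure.prod_apply measurableSet_diagonal]
      have : ∀ x : 𝕏, Prod.mk x ⁻¹' diagonal 𝕏 = {x} := fun x => by ext; simp [eq_comm]
      simp [this]
    rw [← h1, Measure.map_apply ((hX i).prodMk (hX j)) measurableSet_diagonal] at h2
    rw [ae_iff]
    simpa [diagonal, preimage] using h2
  have h' : ∀ᵐ ω ∂P, ∀ i j, i ≠ j → X i ω ≠ X j ω := by
    simp_rw [ae_all_iff]
    exact h
  filter_upwards [h'] with ω hω i j hij
  by_contra hne
  exact hω i j hne hij

lemma measurable_listWeight {w : ℕ → Ω → ℝ} (hw : ∀ j, Measurable (w j)) {m : ℕ} (J : Fin m → ℕ) :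
    Measurable fun ω => listWeight (fun j => w j ω) J := by
  unfold listWeight
  split_ifs
  · refine Finset.measurable_prod _ fun i _ => ?_
    exact (hw _).ennreal_ofReal.mul (measurable_tailSum hw _ measurable_real_toNNReal).inv
  · exact measurable_const

/-- The labels are not functions of `G`, so the conditional law is integrated over events of `G`
before the atomic representation is inserted. `G` is kept in the joint law because the rates of the
times depend on it. -/
theorem map_measure_lists [IsProbabilityMeasure P] [MeasurableSingletonClass 𝕏] {L m : ℕ}
    {G : Ω → Measure 𝕏} {Y : Ω → Fin L → Fin m → 𝕏} {Z : Ω → Fin L → Fin m → ℝ}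
    {w : ℕ → Ω → ℝ} {X : ℕ → Ω → 𝕏} (hGm : Measurable G)
    (hw : ∀ j, Measurable (w j)) (hX : ∀ j, Measurable (X j))
    (hpos : ∀ᵐ ω ∂P, ∀ j, 0 < w j ω) (hfin : ∀ᵐ ω ∂P, ∑' j, ENNReal.ofReal (w j ω) < ∞)
    (hinj : ∀ᵐ ω ∂P, Function.Injective fun j => X j ω)
    (hG : ∀ᵐ ω ∂P, G ω = atomicMeasure (fun j => w j ω) (fun j => X j ω))
    (hYZ : IsPlackettLuceSample P G Y Z) :
    P.map (fun ω => (G ω, Y ω)) = Measure.sum fun J : Fin L → Fin m → ℕ =>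
      (P.withDensity fun ω => ∏ ℓ, listWeight (fun j => w j ω) (J ℓ)).map
        (fun ω => (G ω, fun ℓ i => X (J ℓ i) ω)) := by
  have hY := hYZ.measurable_lists
  have hmle : MeasurableSpace.comap G inferInstance ≤ mΩ := hGm.comap_le
  have hXJ : ∀ J : Fin L → Fin m → ℕ, Measurable fun ω => (fun ℓ i => X (J ℓ i) ω) :=
    fun J => by fun_prop
  have : IsProbabilityMeasure (P.map fun ω => (G ω, Y ω)) :=
    Measure.isProbabilityMeasure_map (by fun_prop)
  -- Total mass one is read off from the conditional probability of the sure event, so the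
  -- Plackett–Luce weights need not be summed.
  have hone : ∀ᵐ ω ∂P, (Measure.pi fun _ : Fin L => plackettLuce (G ω) m) univ = 1 := by
    filter_upwards [hYZ.cond_lists univ MeasurableSet.univ] with ω hω
    rw [preimage_univ, indicator_univ, condExp_const hmle] at hω
    simpa [measureReal_def, ENNReal.toReal_eq_one_iff] using hω.symm
  refine Measure.ext_prod fun {C A} hC hA => ?_
  rw [Measure.map_apply (by fun_prop) (hC.prod hA), Measure.sum_apply _ (hC.prod hA)]
  have h1 := measure_inter_eq_setLIntegral_of_condProb hmle (hY hA) ⟨C, hC, rfl⟩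
    (fun ω => measureReal_nonneg) (hYZ.cond_lists A hA)
  have h2 : ∀ J : Fin L → Fin m → ℕ,
      ((P.withDensity fun ω => ∏ ℓ, listWeight (fun j => w j ω) (J ℓ)).map
        (fun ω => (G ω, fun ℓ i => X (J ℓ i) ω))) (C ×ˢ A)
      = ∫⁻ ω in G ⁻¹' C, (∏ ℓ, listWeight (fun j => w j ω) (J ℓ)) *
          A.indicator 1 (fun ℓ i => X (J ℓ i) ω) ∂P := by
    intro J
    rw [Measure.map_apply (hGm.prodMk (hXJ J)) (hC.prod hA), mk_preimage_prod,
      withDensity_apply _ ((hGm hC).inter (hXJ J hA)), inter_comm,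
      ← Measure.restrict_restrict (hXJ J hA), ← lintegral_indicator (hXJ J hA)]
    refine lintegral_congr fun ω => ?_
    by_cases h : (fun ℓ i => X (J ℓ i) ω) ∈ A
    · rw [indicator_of_mem h, indicator_of_mem (by exact h)]; simp
    · rw [indicator_of_notMem h, indicator_of_notMem (by exact h)]; simp
  simp_rw [h2]
  rw [mk_preimage_prod, h1, ← lintegral_tsum]
  · refine setLIntegral_congr_fun_ae (hGm hC) ?_
    filter_upwards [hone, hpos, hfin, hinj, hG] with ω h1 hp hf hi hGω _
    rw [ofReal_measureReal (by
      exact ne_top_of_le_ne_top ENNReal.one_ne_top (h1 ▸ measure_mono (subset_univ A))), hGω,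
      pi_plackettLuce_atomicMeasure hi hp hf, Measure.sum_apply _ hA]
    refine tsum_congr fun J => ?_
    rw [Measure.smul_apply, Measure.dirac_apply' _ hA, smul_eq_mul]
  · intro J
    refine ((Finset.measurable_prod _ fun ℓ _ => measurable_listWeight hw _).mul
      ((measurable_one.indicator hA).comp (hXJ J))).aemeasurable

end Conditional

/-! ### The latent times -/

/-- The set of the arrays with positive entries. -/
def positiveTimes (L m : ℕ) : Set (Fin L → Fin m → ℝ) := {z | ∀ ℓ i, 0 < z ℓ i}

lemma measurableSet_positiveTimes (L m : ℕ) : MeasurableSet (positiveTimes L m) := by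
  have : positiveTimes L m = ⋂ ℓ, ⋂ i, {z | 0 < z ℓ i} := by ext; simp [positiveTimes]
  rw [this]
  exact MeasurableSet.iInter fun ℓ => MeasurableSet.iInter fun i =>
    measurableSet_lt measurable_const (by fun_prop)

/-- The density of independent exponential times with rates `r` on the positive arrays. -/
def timesDensity {L m : ℕ} (r : Fin L → Fin m → ℝ≥0∞) (z : Fin L → Fin m → ℝ) : ℝ≥0∞ :=
  ∏ ℓ, ∏ i, r ℓ i * expNeg (r ℓ i * ENNReal.ofReal (z ℓ i))

lemma measurable_timesDensity {L m : ℕ} : Measurable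
    fun p : (Fin L → Fin m → ℝ≥0∞) × (Fin L → Fin m → ℝ) => timesDensity p.1 p.2 := by
  unfold timesDensity
  fun_prop

lemma measurable_timesDensity_right {L m : ℕ} (r : Fin L → Fin m → ℝ≥0∞) :
    Measurable (timesDensity r) := by
  unfold timesDensity
  fun_prop

lemma expMeasure_toReal {r : ℝ≥0∞} (hr0 : r ≠ 0) (hr : r ≠ ∞) :
    expMeasure r.toReal = (volume.restrict (Ioi 0)).withDensity
      fun z => r * expNeg (r * ENNReal.ofReal z) := by
  have hpos : 0 < r.toReal := ENNReal.toReal_pos hr0 hr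
  have h1 : expMeasure r.toReal = volume.withDensity (exponentialPDF r.toReal) := rfl
  rw [h1, restrict_Ioi_eq_restrict_Ici, ← withDensity_indicator measurableSet_Ici]
  congr 1
  ext z
  rw [exponentialPDF_eq]
  by_cases hz : 0 ≤ z
  · rw [if_pos hz, indicator_of_mem (by exact hz), ENNReal.ofReal_mul hpos.le,
      ENNReal.ofReal_toReal hr, ← expNeg_ofReal (mul_nonneg hpos.le hz),
      ENNReal.ofReal_mul hpos.le, ENNReal.ofReal_toReal hr]
  · rw [if_neg hz, indicator_of_notMem (by exact hz), ENNReal.ofReal_zero]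

lemma pi_expMeasure {L m : ℕ} {r : Fin L → Fin m → ℝ≥0∞} (hr0 : ∀ ℓ i, r ℓ i ≠ 0)
    (hr : ∀ ℓ i, r ℓ i ≠ ∞) :
    (Measure.pi fun ℓ => Measure.pi fun i => expMeasure (r ℓ i).toReal)
      = (volume.restrict (positiveTimes L m)).withDensity (timesDensity r) := by
  have hprob : ∀ ℓ i, IsProbabilityMeasure (expMeasure (r ℓ i).toReal) := fun ℓ i =>
    isProbabilityMeasure_expMeasure (ENNReal.toReal_pos (hr0 ℓ i) (hr ℓ i))
  have hs : ∀ ℓ i, SigmaFinite ((volume.restrict (Ioi 0)).withDensity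
      fun z => r ℓ i * expNeg (r ℓ i * ENNReal.ofReal z)) := fun ℓ i => by
    rw [← expMeasure_toReal (hr0 ℓ i) (hr ℓ i)]
    infer_instance
  have h1 : ∀ ℓ, (Measure.pi fun i => expMeasure (r ℓ i).toReal)
      = (Measure.pi fun _ : Fin m => (volume.restrict (Ioi (0 : ℝ)))).withDensity
        fun z => ∏ i, r ℓ i * expNeg (r ℓ i * ENNReal.ofReal (z i)) := fun ℓ => by
    simp_rw [expMeasure_toReal (hr0 _ _) (hr _ _)]
    exact pi_withDensity _ _ (fun i => by fun_prop)
  have hs' : ∀ ℓ, SigmaFinite ((Measure.pi fun _ : Fin m =>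
      (volume.restrict (Ioi (0 : ℝ)))).withDensity
        fun z => ∏ i, r ℓ i * expNeg (r ℓ i * ENNReal.ofReal (z i))) := fun ℓ => by
    rw [← h1]
    infer_instance
  simp_rw [h1]
  rw [pi_withDensity _ _ (fun ℓ => by fun_prop), ← Measure.restrict_pi_pi]
  congr 1
  rw [← Measure.restrict_pi_pi]
  have h2 : positiveTimes L m = univ.pi fun _ => univ.pi fun _ => Ioi 0 := by
    ext; simp [positiveTimes]
  rw [h2]
  rfl

/-- Measures of sections depend measurably on the parameter for finite kernels. Keeping `g` only
where its mass is at most `n` gives such a kernel, and the supremum over `n` recovers every finite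
`g`. -/
lemma exists_measurable_section {E 𝕏 : Type*} [MeasurableSpace E] [MeasurableSpace 𝕏]
    {s : Set (E × 𝕏)} (hs : MeasurableSet s) :
    ∃ F : Measure 𝕏 × E → ℝ≥0∞, Measurable F ∧
      ∀ g y, g univ < ∞ → F (g, y) = g (Prod.mk y ⁻¹' s) := by
  classical
  have hset : ∀ n : ℕ, MeasurableSet {p : Measure 𝕏 × E | p.1 univ ≤ n} := fun n =>
    measurableSet_le ((Measure.measurable_coe MeasurableSet.univ).comp measurable_fst)
      measurable_const
  let κ : ℕ → Kernel (Measure 𝕏 × E) 𝕏 := fun n =>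
    { toFun := fun p => if p.1 univ ≤ n then p.1 else 0
      measurable' := Measurable.ite (hset n) measurable_fst measurable_const }
  have hκ : ∀ n p, κ n p = if p.1 univ ≤ n then p.1 else 0 := fun n p => rfl
  have hfinite : ∀ n, IsFiniteKernel (κ n) := fun n => ⟨n, ENNReal.natCast_lt_top n, fun p => by
    rw [hκ]
    split_ifs with h
    · exact h
    · simp⟩
  let t : Set ((Measure 𝕏 × E) × 𝕏) := {p | (p.1.2, p.2) ∈ s}
  have ht : MeasurableSet t := by
    have : Measurable fun p : (Measure 𝕏 × E) × 𝕏 => (p.1.2, p.2) := by fun_prop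
    exact this hs
  refine ⟨fun p => ⨆ n, κ n p (Prod.mk p ⁻¹' t),
    Measurable.iSup fun n => Kernel.measurable_kernel_prodMk_left ht, fun g y hg => ?_⟩
  refine le_antisymm (iSup_le fun n => ?_) ?_
  · rw [hκ]
    split_ifs
    · rfl
    · simp
  · obtain ⟨n, hn⟩ := ENNReal.exists_nat_gt hg.ne
    refine le_iSup_of_le n ?_
    rw [hκ, if_pos hn.le]
    rfl

lemma exists_measurable_remaining (𝕏 : Type*) [MeasurableSpace 𝕏] [MeasurableEq 𝕏] (L m : ℕ) :
    ∃ F : Measure 𝕏 × (Fin L → Fin m → 𝕏) → Fin L → Fin m → ℝ≥0∞, Measurable F ∧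
      ∀ g y, g univ < ∞ → F (g, y) = fun ℓ i => g (remaining (y ℓ) i) := by
  have hs : ∀ (ℓ : Fin L) (i : Fin m), MeasurableSet
      {p : (Fin L → Fin m → 𝕏) × 𝕏 | p.2 ∈ remaining (p.1 ℓ) i} := by
    intro ℓ i
    have : {p : (Fin L → Fin m → 𝕏) × 𝕏 | p.2 ∈ remaining (p.1 ℓ) i}
        = ⋂ j : Fin m, ⋂ _ : j < i, {p | p.1 ℓ j = p.2}ᶜ := by
      ext; simp [remaining]
    rw [this]
    exact MeasurableSet.iInter fun j => MeasurableSet.iInter fun _ =>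
      (measurableSet_eq_fun (by fun_prop) (by fun_prop)).compl
  choose F hF hFg using fun ℓ i => exists_measurable_section (hs ℓ i)
  refine ⟨fun p ℓ i => F ℓ i p, by fun_prop, fun g y hg => ?_⟩
  ext ℓ i
  exact hFg ℓ i g y hg

/-- The joint weight of the lists of labels `J` and of the times `z` given the masses `w`. -/
def labelDensity {L m : ℕ} (w : ℕ → ℝ) (J : Fin L → Fin m → ℕ) (z : Fin L → Fin m → ℝ) : ℝ≥0∞ :=
  ∏ ℓ, ∏ i, ENNReal.ofReal (w (J ℓ i)) *
    expNeg (restMass w (J ℓ) i * ENNReal.ofReal (z ℓ i))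

/-- The rate in front of each exponential density cancels the Plackett–Luce denominator of the same
stage. -/
lemma listWeight_mul_timesDensity {L m : ℕ} {w : ℕ → ℝ} {J : Fin L → Fin m → ℕ}
    (hJ : ∀ ℓ, Function.Injective (J ℓ)) (h0 : ∀ ℓ i, restMass w (J ℓ) i ≠ 0)
    (htop : ∀ ℓ i, restMass w (J ℓ) i ≠ ∞) (z : Fin L → Fin m → ℝ) :
    (∏ ℓ, listWeight w (J ℓ)) * timesDensity (fun ℓ i => restMass w (J ℓ) i) z
      = labelDensity w J z := by
  simp_rw [listWeight, if_pos (hJ _)]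
  rw [timesDensity, labelDensity, ← Finset.prod_mul_distrib]
  refine Finset.prod_congr rfl fun ℓ _ => ?_
  rw [← Finset.prod_mul_distrib]
  refine Finset.prod_congr rfl fun i _ => ?_
  rw [mul_assoc, ← mul_assoc _⁻¹, ENNReal.inv_mul_cancel (h0 ℓ i) (htop ℓ i), one_mul]

section Joint

variable {Ω 𝕏 : Type*} [mΩ : MeasurableSpace Ω] [MeasurableSpace 𝕏] {P : Measure Ω}

lemma measurable_labelDensity {w : ℕ → Ω → ℝ} (hw : ∀ j, Measurable (w j)) {L m : ℕ}
    (J : Fin L → Fin m → ℕ) : Measurable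
      fun p : Ω × (Fin L → Fin m → ℝ) => labelDensity (fun j => w j p.1) J p.2 := by
  have h : ∀ ℓ i, Measurable fun p : Ω × (Fin L → Fin m → ℝ) =>
      restMass (fun j => w j p.1) (J ℓ) i := fun ℓ i =>
    (measurable_tailSum hw _ measurable_real_toNNReal).comp measurable_fst
  unfold labelDensity
  fun_prop

lemma measurable_labelDensity_left {w : ℕ → Ω → ℝ} (hw : ∀ j, Measurable (w j)) {L m : ℕ}
    (J : Fin L → Fin m → ℕ) (z : Fin L → Fin m → ℝ) :
    Measurable fun ω => labelDensity (fun j => w j ω) J z := by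
  have h : ∀ ℓ i, Measurable fun ω => restMass (fun j => w j ω) (J ℓ) i := fun ℓ i =>
    measurable_tailSum hw _ measurable_real_toNNReal
  unfold labelDensity
  fun_prop

open Classical in
theorem measure_lists_times [IsProbabilityMeasure P] [MeasurableEq 𝕏] {L m : ℕ}
    {G : Ω → Measure 𝕏} {Y : Ω → Fin L → Fin m → 𝕏} {Z : Ω → Fin L → Fin m → ℝ}
    {w : ℕ → Ω → ℝ} {X : ℕ → Ω → 𝕏} (hGm : Measurable G)
    (hw : ∀ j, Measurable (w j)) (hX : ∀ j, Measurable (X j))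
    (hpos : ∀ᵐ ω ∂P, ∀ j, 0 < w j ω) (hfin : ∀ᵐ ω ∂P, ∑' j, ENNReal.ofReal (w j ω) < ∞)
    (hinj : ∀ᵐ ω ∂P, Function.Injective fun j => X j ω)
    (hG : ∀ᵐ ω ∂P, G ω = atomicMeasure (fun j => w j ω) (fun j => X j ω))
    (hYZ : IsPlackettLuceSample P G Y Z) {A : Set (Fin L → Fin m → 𝕏)} (hA : MeasurableSet A)
    {B : Set (Fin L → Fin m → ℝ)} (hB : MeasurableSet B) :
    P (Y ⁻¹' A ∩ Z ⁻¹' B) = ∑' J : Fin L → Fin m → ℕ,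
      if ∀ ℓ, Function.Injective (J ℓ) then
        ∫⁻ ω, A.indicator 1 (fun ℓ i => X (J ℓ i) ω) *
          (∫⁻ z in B ∩ positiveTimes L m, labelDensity (fun j => w j ω) J z) ∂P
      else 0 := by
  have hY := hYZ.measurable_lists
  have hZ := hYZ.measurable_times
  have hGY : Measurable fun ω => (G ω, Y ω) := hGm.prodMk hY
  obtain ⟨F, hF, hFg⟩ := exists_measurable_remaining 𝕏 L m
  -- The conditional probability of `B` as a measurable function of `(G, Y)`, so that only the law
  -- of this pair, known from `map_measure_lists`, enters.
  let Φ : Measure 𝕏 × (Fin L → Fin m → 𝕏) → ℝ≥0∞ := fun p =>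
    ∫⁻ z in B ∩ positiveTimes L m, timesDensity (F p) z
  have hΦ : Measurable Φ := by
    have : Measurable fun q : (Measure 𝕏 × (Fin L → Fin m → 𝕏)) × (Fin L → Fin m → ℝ) =>
        timesDensity (F q.1) q.2 :=
      measurable_timesDensity.comp ((hF.comp measurable_fst).prodMk measurable_snd)
    exact this.lintegral_prod_right'
  have h1 := measure_inter_eq_setLIntegral_of_condProb hGY.comap_le (hZ hB)
    ⟨univ ×ˢ A, MeasurableSet.univ.prod hA, rfl⟩
    (fun ω => measureReal_nonneg) (hYZ.cond_times B hB)
  have h2 : (fun ω => (G ω, Y ω)) ⁻¹' (univ ×ˢ A) = Y ⁻¹' A := by ext; simp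
  have h3 : ∫⁻ ω in Y ⁻¹' A, ENNReal.ofReal ((Measure.pi fun ℓ : Fin L => Measure.pi
        fun i : Fin m => expMeasure (G ω (remaining (Y ω ℓ) i)).toReal).real B) ∂P
      = ∫⁻ p in univ ×ˢ A, Φ p ∂(P.map fun ω => (G ω, Y ω)) := by
    rw [setLIntegral_map (MeasurableSet.univ.prod hA) hΦ hGY, h2]
    refine setLIntegral_congr_fun_ae (hY hA) ?_
    filter_upwards [hpos, hfin, hinj, hG] with ω hp hf hi hGω _
    have hGfin : G ω univ < ∞ := by rwa [hGω, atomicMeasure_univ]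
    have hr0 : ∀ ℓ i, G ω (remaining (Y ω ℓ) i) ≠ 0 := fun ℓ i => by
      rw [hGω]
      exact atomicMeasure_remaining_ne_zero hi hp _ i
    have hr : ∀ ℓ i, G ω (remaining (Y ω ℓ) i) ≠ ∞ := fun ℓ i =>
      ne_top_of_le_ne_top hGfin.ne (measure_mono (subset_univ _))
    have : ∀ ℓ i, IsProbabilityMeasure (expMeasure (G ω (remaining (Y ω ℓ) i)).toReal) :=
      fun ℓ i => isProbabilityMeasure_expMeasure (ENNReal.toReal_pos (hr0 ℓ i) (hr ℓ i))
    rw [ofReal_measureReal (measure_ne_top _ _), pi_expMeasure hr0 hr, withDensity_apply _ hB,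
      Measure.restrict_restrict hB]
    simp only [Φ, hFg _ _ hGfin]
  rw [h2] at h1
  rw [h1, h3, map_measure_lists hGm hw hX hpos hfin hinj hG hYZ,
    Measure.restrict_sum _ (MeasurableSet.univ.prod hA), lintegral_sum_measure]
  refine tsum_congr fun J => ?_
  have hXJ : Measurable fun ω => (fun ℓ i => X (J ℓ i) ω) := by fun_prop
  have hGX : Measurable fun ω => (G ω, fun ℓ i => X (J ℓ i) ω) := hGm.prodMk hXJ
  have hΦX : Measurable fun ω => Φ (G ω, fun ℓ i => X (J ℓ i) ω) := hΦ.comp hGX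
  have hW : Measurable fun ω => ∏ ℓ, listWeight (fun j => w j ω) (J ℓ) :=
    Finset.measurable_prod _ fun ℓ _ => measurable_listWeight hw _
  have h4 : (fun ω => (G ω, fun ℓ i => X (J ℓ i) ω)) ⁻¹' (univ ×ˢ A)
      = (fun ω => (fun ℓ i => X (J ℓ i) ω)) ⁻¹' A := by ext; simp
  rw [setLIntegral_map (MeasurableSet.univ.prod hA) hΦ hGX, h4,
    restrict_withDensity (hXJ hA), lintegral_withDensity_eq_lintegral_mul _ hW hΦX,
    ← lintegral_indicator (hXJ hA)]
  split_ifs with hJ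
  · refine lintegral_congr_ae ?_
    filter_upwards [hpos, hfin, hinj, hG] with ω hp hf hi hGω
    by_cases hωA : (fun ℓ i => X (J ℓ i) ω) ∈ A
    · rw [indicator_of_mem (by exact hωA), indicator_of_mem hωA, Pi.one_apply, one_mul]
      have hGfin : G ω univ < ∞ := by rwa [hGω, atomicMeasure_univ]
      have hR : ∀ ℓ i, G ω (remaining (fun i => X (J ℓ i) ω) i)
          = restMass (fun j => w j ω) (J ℓ) i := fun ℓ i => by
        rw [hGω]
        exact atomicMeasure_remaining hi (J ℓ) i
      have hr0 : ∀ ℓ i, restMass (fun j => w j ω) (J ℓ) i ≠ 0 := fun ℓ i => by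
        rw [← hR, hGω]
        exact atomicMeasure_remaining_ne_zero hi hp _ i
      have hr : ∀ ℓ i, restMass (fun j => w j ω) (J ℓ) i ≠ ∞ := fun ℓ i => by
        rw [← hR]
        exact ne_top_of_le_ne_top hGfin.ne (measure_mono (subset_univ _))
      simp only [Pi.mul_apply, Φ, hFg _ _ hGfin, hR]
      rw [← lintegral_const_mul _ (measurable_timesDensity_right _)]
      exact lintegral_congr fun z => listWeight_mul_timesDensity hJ hr0 hr z
    · rw [indicator_of_notMem (by exact hωA), indicator_of_notMem hωA, zero_mul]
  · push Not at hJ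
    obtain ⟨ℓ, hℓ⟩ := hJ
    have h0 : ∀ ω, ∏ ℓ, listWeight (fun j => w j ω) (J ℓ) = 0 := fun ω =>
      Finset.prod_eq_zero (Finset.mem_univ ℓ) (by rw [listWeight, if_neg hℓ])
    rw [lintegral_eq_zero_iff']
    · filter_upwards with ω
      simp [indicator, h0]
    · exact ((hW.mul hΦX).indicator (hXJ hA)).aemeasurable

end Joint

/-! ### Patterns of ties -/

section Patterns

variable {L m : ℕ}

instance finite_setoid (α : Type*) [Finite α] : Finite (Setoid α) :=
  Finite.of_injective (fun s : Setoid α => fun a b => s a b) fun s t h => by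
    ext a b
    exact iff_of_eq (congrFun (congrFun h a) b)

/-- The classes of the pattern `s` are met at most once in every list. -/
def Separates (s : Setoid (Fin L × Fin m)) : Prop :=
  ∀ ℓ, Function.Injective fun i => Quotient.mk s (ℓ, i)

open Classical in
/-- The size of a class of the pattern `s`. -/
def classCard (s : Setoid (Fin L × Fin m)) (k : Quotient s) : ℕ :=
  (Finset.univ.filter fun p : Fin L × Fin m => Quotient.mk s p = k).card

open Classical in
/-- The total time during which the items of class `k` are still available. -/
def classTime (s : Setoid (Fin L × Fin m)) (k : Quotient s) (z : Fin L → Fin m → ℝ) : ℝ :=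
  ∑ ℓ, ∑ i, (if ∃ j, j < i ∧ Quotient.mk s (ℓ, j) = k then 0 else 1) * z ℓ i

lemma classCard_pos (s : Setoid (Fin L × Fin m)) (k : Quotient s) : 1 ≤ classCard s k := by
  obtain ⟨p, rfl⟩ := Quotient.exists_rep k
  exact Finset.card_pos.2 ⟨p, by simp⟩

/-- The time at a position of class `k` itself counts, since the class cannot occur earlier in that
list. Positivity makes the `κ` integral finite. -/
lemma classTime_pos {s : Setoid (Fin L × Fin m)} (hs : Separates s) (k : Quotient s)
    {z : Fin L → Fin m → ℝ} (hz : z ∈ positiveTimes L m) : 0 < classTime s k z := by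
  classical
  obtain ⟨⟨ℓ, i⟩, rfl⟩ := Quotient.exists_rep k
  have hnonneg : ∀ ℓ' i', 0 ≤ (if ∃ j, j < i' ∧ Quotient.mk s (ℓ', j) = Quotient.mk s (ℓ, i)
      then (0 : ℝ) else 1) * z ℓ' i' := fun ℓ' i' =>
    mul_nonneg (by split_ifs <;> norm_num) (hz ℓ' i').le
  refine Finset.sum_pos' (fun ℓ' _ => Finset.sum_nonneg fun i' _ => hnonneg ℓ' i')
    ⟨ℓ, Finset.mem_univ _, Finset.sum_pos' (fun i' _ => hnonneg ℓ i') ⟨i, Finset.mem_univ _, ?_⟩⟩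
  rw [if_neg, one_mul]
  · exact hz ℓ i
  · rintro ⟨j, hj, h⟩
    exact hj.ne (hs ℓ h)

/-- An array of labels is a pattern of ties together with distinct labels for its classes. -/
def labelEquiv (L m : ℕ) :
    (Σ s : Setoid (Fin L × Fin m), (Quotient s ↪ ℕ)) ≃ (Fin L → Fin m → ℕ) :=
  Equiv.ofBijective (fun p ℓ i => p.2 (Quotient.mk p.1 (ℓ, i))) <| by
    constructor
    · rintro ⟨s, ι⟩ ⟨t, ι'⟩ h
      have h' : ∀ p : Fin L × Fin m, ι (Quotient.mk s p) = ι' (Quotient.mk t p) := fun p =>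
        congrFun (congrFun h p.1) p.2
      have hst : s = t := by
        ext p q
        have h1 : s p q ↔ ι (Quotient.mk s p) = ι (Quotient.mk s q) :=
          ⟨fun hpq => congrArg ι (Quotient.sound hpq), fun hpq => Quotient.exact (ι.injective hpq)⟩
        have h2 : t p q ↔ ι' (Quotient.mk t p) = ι' (Quotient.mk t q) :=
          ⟨fun hpq => congrArg ι' (Quotient.sound hpq),
            fun hpq => Quotient.exact (ι'.injective hpq)⟩
        rw [h1, h2, h', h']
      subst hst
      congr 1
      ext k
      obtain ⟨p, rfl⟩ := Quotient.exists_rep k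
      exact h' p
    · intro J
      refine ⟨⟨Setoid.ker fun p : Fin L × Fin m => J p.1 p.2,
        ⟨Setoid.kerLift _, Setoid.kerLift_injective _⟩⟩, ?_⟩
      rfl

lemma labelEquiv_apply (s : Setoid (Fin L × Fin m)) (ι : Quotient s ↪ ℕ) :
    labelEquiv L m ⟨s, ι⟩ = fun ℓ i => ι (Quotient.mk s (ℓ, i)) := rfl

lemma tailSum_eq_sum_add {α S : Type*} [Fintype α] (ι : α ↪ ℕ) {s : Set ℕ} (hs : s ⊆ range ι)
    (φ : S → ℝ≥0) (x : ℕ → S) [DecidablePred (· ∈ s)] :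
    tailSum s φ x = (∑ a, if ι a ∈ s then 0 else (φ (x (ι a)) : ℝ≥0∞))
      + tailSum (range ι) φ x := by
  have h1 : ∑ a, (if ι a ∈ s then 0 else (φ (x (ι a)) : ℝ≥0∞))
      = ∑' j, (range ι).indicator (sᶜ.indicator fun j => (φ (x j) : ℝ≥0∞)) j := by
    rw [← tsum_subtype (range ι) (sᶜ.indicator fun j => (φ (x j) : ℝ≥0∞)),
      tsum_range _ ι.injective, tsum_fintype]
    refine Finset.sum_congr rfl fun a _ => ?_
    by_cases h : ι a ∈ s <;> simp [h]
  rw [h1, tailSum, tailSum, ← ENNReal.tsum_add]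
  refine tsum_congr fun j => ?_
  by_cases hj : j ∈ range ι
  · simp [hj]
  · have hjs : j ∉ s := fun h => hj (hs h)
    simp only [indicator, mem_compl_iff, hj, hjs, not_false_eq_true, if_true, if_false, zero_add]

lemma tailSum_smul {S : Type*} (s : Set ℕ) (φ : S → ℝ≥0) (t : ℝ≥0) (x : ℕ → S) :
    tailSum s (fun y => t * φ y) x = t * tailSum s φ x := by
  unfold tailSum
  rw [← ENNReal.tsum_mul_left]
  refine tsum_congr fun j => ?_
  by_cases hj : j ∈ sᶜ <;> simp [hj]

/-- Regrouping by atoms instead of positions: a listed atom is exposed for its `classTime`, all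
others for the whole of `∑ z`. This is the integrand of `palm_formula`. -/
lemma labelDensity_eq (s : Setoid (Fin L × Fin m)) (ι : Quotient s ↪ ℕ) {w : ℕ → ℝ}
    (hw : ∀ j, 0 < w j) {z : Fin L → Fin m → ℝ} (hz : z ∈ positiveTimes L m) [Fintype (Quotient s)] :
    labelDensity w (fun ℓ i => ι (Quotient.mk s (ℓ, i))) z
      = (∏ k, (Real.toNNReal (w (ι k) ^ classCard s k *
            Real.exp (-classTime s k z * w (ι k))) : ℝ≥0∞)) *
          expNeg (tailSum (range ι)
            (fun y => Real.toNNReal (∑ ℓ, ∑ i, z ℓ i) * Real.toNNReal y) w) := by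
  classical
  have hz0 : ∀ ℓ i, 0 ≤ z ℓ i := fun ℓ i => (hz ℓ i).le
  set c : Fin L → Fin m → Quotient s → ℝ := fun ℓ i k =>
    if ∃ j, j < i ∧ Quotient.mk s (ℓ, j) = k then 0 else 1 with hc
  have hc0 : ∀ ℓ i k, 0 ≤ c ℓ i k := fun ℓ i k => by
    simp only [hc]; split_ifs <;> norm_num
  have hct0 : ∀ k, 0 ≤ classTime s k z := fun k =>
    Finset.sum_nonneg fun ℓ _ => Finset.sum_nonneg fun i _ => mul_nonneg (hc0 ℓ i k) (hz0 ℓ i)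
  have hrest : ∀ ℓ i, restMass w (fun i => ι (Quotient.mk s (ℓ, i))) i
      = (∑ k, ENNReal.ofReal (c ℓ i k) * ENNReal.ofReal (w (ι k)))
        + tailSum (range ι) Real.toNNReal w := by
    intro ℓ i
    rw [restMass, tailSum_eq_sum_add ι]
    · congr 1
      refine Finset.sum_congr rfl fun k _ => ?_
      simp only [mem_ofPred_eq, ι.injective.eq_iff, hc]
      split_ifs <;> simp [ENNReal.ofReal]
    · rintro _ ⟨j, _, rfl⟩
      exact mem_range_self _
  have hmass : ∏ ℓ, ∏ i, ENNReal.ofReal (w (ι (Quotient.mk s (ℓ, i))))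
      = ∏ k, ENNReal.ofReal (w (ι k)) ^ classCard s k := by
    rw [← Fintype.prod_prod_type' (f := fun ℓ i => ENNReal.ofReal (w (ι (Quotient.mk s (ℓ, i))))),
      ← Finset.prod_fiberwise (s := Finset.univ) (g := Quotient.mk s)]
    refine Finset.prod_congr rfl fun k _ => ?_
    rw [Finset.prod_congr rfl (g := fun _ => ENNReal.ofReal (w (ι k))), Finset.prod_const]
    · rfl
    · rintro p hp
      rw [← (Finset.mem_filter.1 hp).2]
  have htime : ∑ ℓ, ∑ i, restMass w (fun i => ι (Quotient.mk s (ℓ, i))) i * ENNReal.ofReal (z ℓ i)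
      = (∑ k, ENNReal.ofReal (classTime s k z) * ENNReal.ofReal (w (ι k)))
        + tailSum (range ι) (fun y => Real.toNNReal (∑ ℓ, ∑ i, z ℓ i) * Real.toNNReal y) w := by
    simp_rw [hrest, add_mul, Finset.sum_add_distrib]
    congr 1
    · simp_rw [Finset.sum_mul]
      have : ∀ ℓ, ∑ i, ∑ k, ENNReal.ofReal (c ℓ i k) * ENNReal.ofReal (w (ι k)) *
          ENNReal.ofReal (z ℓ i) = ∑ k, ∑ i, ENNReal.ofReal (c ℓ i k) * ENNReal.ofReal (w (ι k)) *
          ENNReal.ofReal (z ℓ i) := fun ℓ => Finset.sum_comm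
      simp_rw [this]
      rw [Finset.sum_comm]
      refine Finset.sum_congr rfl fun k _ => ?_
      rw [classTime, ENNReal.ofReal_sum_of_nonneg
        (fun ℓ _ => Finset.sum_nonneg fun i _ => mul_nonneg (hc0 ℓ i k) (hz0 ℓ i)), Finset.sum_mul]
      refine Finset.sum_congr rfl fun ℓ _ => ?_
      rw [ENNReal.ofReal_sum_of_nonneg (fun i _ => mul_nonneg (hc0 ℓ i k) (hz0 ℓ i)),
        Finset.sum_mul]
      refine Finset.sum_congr rfl fun i _ => ?_
      rw [ENNReal.ofReal_mul (hc0 ℓ i k)]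
      ring
    · rw [tailSum_smul]
      simp_rw [← Finset.mul_sum]
      rw [mul_comm]
      congr 1
      change _ = ENNReal.ofReal _
      rw [ENNReal.ofReal_sum_of_nonneg (fun ℓ _ => Finset.sum_nonneg fun i _ => hz0 ℓ i)]
      refine Finset.sum_congr rfl fun ℓ _ => ?_
      rw [ENNReal.ofReal_sum_of_nonneg (fun i _ => hz0 ℓ i)]
  rw [labelDensity]
  simp_rw [Finset.prod_mul_distrib]
  rw [hmass]
  simp_rw [← expNeg_sum]
  rw [htime, expNeg_add, ← mul_assoc, expNeg_sum, ← Finset.prod_mul_distrib]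
  congr 1
  refine Finset.prod_congr rfl fun k _ => ?_
  change _ = ENNReal.ofReal _
  rw [ENNReal.ofReal_mul (pow_nonneg (hw _).le _), ENNReal.ofReal_pow (hw _).le, neg_mul,
    ← expNeg_ofReal (mul_nonneg (hct0 k) (hw _).le), ENNReal.ofReal_mul (hct0 k)]

end Patterns

/-! ### The density on a pattern of ties -/

section Density

variable {𝕏 : Type*} {L m : ℕ} {lam : ℝ → ℝ≥0}

open Classical in
/-- The part of the marginal density that depends on the times, on the pattern of ties `s`. -/
def patternDensity (lam : ℝ → ℝ≥0) (s : Setoid (Fin L × Fin m)) (z : Fin L → Fin m → ℝ) : ℝ :=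
  Real.exp (-psi lam (∑ ℓ, ∑ i, z ℓ i)) * ∏ k, kappa lam (classCard s k) (classTime s k z)

-- When the ties of `y` are exactly those of `s`, the classes correspond bijectively to the distinct
-- items, through the value of `y` at a representative.
open Classical in
lemma marginalDensity_eq {s : Setoid (Fin L × Fin m)} {y : Fin L → Fin m → 𝕏}
    (hy : ∀ p q, s p q ↔ y p.1 p.2 = y q.1 q.2) (h : 𝕏 → ℝ≥0) (z : Fin L → Fin m → ℝ) :
    marginalDensity lam h y z
      = (∏ k : Quotient s, (h (y k.out.1 k.out.2) : ℝ)) * patternDensity lam s z := by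
  set x : Quotient s → 𝕏 := fun k => y k.out.1 k.out.2 with hx
  have hyx : ∀ p k, y p.1 p.2 = x k ↔ Quotient.mk s p = k := fun p k => by
    rw [hx, ← hy]
    exact Quotient.mk_eq_iff_out.symm
  have hxinj : Function.Injective x := fun k k' hkk' => by
    have := (hyx k.out k').1 hkk'
    rwa [Quotient.out_eq] at this
  have hitems : items y = Finset.univ.image x := by
    ext a
    simp only [items, Finset.mem_image, Finset.mem_univ, true_and]
    constructor
    · rintro ⟨p, rfl⟩
      exact ⟨Quotient.mk s p, ((hyx p _).2 rfl).symm⟩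
    · rintro ⟨k, rfl⟩
      exact ⟨k.out, rfl⟩
  rw [marginalDensity, hitems, Finset.prod_image hxinj.injOn, patternDensity,
    Finset.prod_mul_distrib, mul_left_comm]
  congr 2
  refine Finset.prod_congr rfl fun k _ => ?_
  congr 1
  · simp_rw [occ, classCard, hyx]
  · simp_rw [classTime, delta]
    refine Finset.sum_congr rfl fun ℓ _ => Finset.sum_congr rfl fun i _ => ?_
    congr 1
    refine if_congr (exists_congr fun j => and_congr_right fun _ => hyx (ℓ, j) k) rfl rfl

lemma measurable_psi (hlam : Measurable lam) : Measurable (psi lam) := by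
  have : StronglyMeasurable fun p : ℝ × ℝ => (1 - Real.exp (-p.1 * p.2)) * (lam p.2 : ℝ) :=
    Measurable.stronglyMeasurable (by fun_prop)
  exact this.integral_prod_right.measurable

lemma measurable_kappa (hlam : Measurable lam) (n : ℕ) : Measurable (kappa lam n) := by
  have : StronglyMeasurable fun p : ℝ × ℝ => p.2 ^ n * Real.exp (-p.1 * p.2) * (lam p.2 : ℝ) :=
    Measurable.stronglyMeasurable (by fun_prop)
  exact this.integral_prod_right.measurable

lemma measurable_patternDensity (hlam : Measurable lam) (s : Setoid (Fin L × Fin m)) :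
    Measurable (patternDensity lam s) := by
  have := measurable_psi hlam
  have := measurable_kappa hlam
  unfold patternDensity classTime
  fun_prop

variable [MeasurableSpace 𝕏]

/-- The product runs over a set of items that varies with `y`, so the space is cut into the finitely
many measurable patterns of ties; on each the index set is fixed. -/
lemma measurable_marginalDensity [MeasurableEq 𝕏] (hlam : Measurable lam) {h : 𝕏 → ℝ≥0}
    (hh : Measurable h) : Measurable
      fun p : (Fin L → Fin m → 𝕏) × (Fin L → Fin m → ℝ) => marginalDensity lam h p.1 p.2 := by
  classical
  let E : Setoid (Fin L × Fin m) → Set ((Fin L → Fin m → 𝕏) × (Fin L → Fin m → ℝ)) := fun s =>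
    {p | ∀ a b, s a b ↔ p.1 a.1 a.2 = p.1 b.1 b.2}
  let f : Setoid (Fin L × Fin m) → (Fin L → Fin m → 𝕏) × (Fin L → Fin m → ℝ) → ℝ := fun s p =>
    (∏ k : Quotient s, (h (p.1 k.out.1 k.out.2) : ℝ)) * patternDensity lam s p.2
  have hf : ∀ s, Measurable (f s) := fun s => by
    have := measurable_patternDensity hlam s
    fun_prop
  have hE : ∀ s, MeasurableSet (E s) := fun s => by
    have : E s = ⋂ a, ⋂ b, {p | s a b ↔ p.1 a.1 a.2 = p.1 b.1 b.2} := by ext; simp [E]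
    rw [this]
    refine MeasurableSet.iInter fun a => MeasurableSet.iInter fun b => ?_
    have hab : MeasurableSet {p : (Fin L → Fin m → 𝕏) × (Fin L → Fin m → ℝ) |
        p.1 a.1 a.2 = p.1 b.1 b.2} := measurableSet_eq_fun (by fun_prop) (by fun_prop)
    by_cases hs : s a b
    · simpa [hs] using hab
    · simp only [hs, false_iff]
      exact hab.compl
  intro t ht
  have : (fun p : (Fin L → Fin m → 𝕏) × (Fin L → Fin m → ℝ) =>
      marginalDensity lam h p.1 p.2) ⁻¹' t = ⋃ s, E s ∩ f s ⁻¹' t := by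
    ext p
    simp only [mem_preimage, mem_iUnion, mem_inter_iff]
    constructor
    · intro hp
      have hker : p ∈ E (Setoid.ker fun a : Fin L × Fin m => p.1 a.1 a.2) := fun a b => Iff.rfl
      refine ⟨_, hker, ?_⟩
      rwa [marginalDensity_eq hker] at hp
    · rintro ⟨s, hs, hp⟩
      rwa [marginalDensity_eq hs]
  rw [this]
  exact MeasurableSet.iUnion fun s => (hE s).inter (hf s ht)

end Density

/-! ### The joint law and the reference measure on rectangles -/

section Final

variable {Ω 𝕏 : Type*} [mΩ : MeasurableSpace Ω] [MeasurableSpace 𝕏] {P : Measure Ω}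
  {lam : ℝ → ℝ≥0} {L m : ℕ}

lemma measurableSet_injective [MeasurableEq 𝕏] (α : Type*) [Finite α] :
    MeasurableSet {x : α → 𝕏 | Function.Injective x} := by
  have : {x : α → 𝕏 | Function.Injective x} = ⋂ a, ⋂ b, ⋂ _ : a ≠ b, {x | x a = x b}ᶜ := by
    ext x
    simp only [mem_ofPred_eq, mem_iInter, mem_compl_iff]
    exact ⟨fun h a b hab hx => hab (h hx), fun h a b hx => by_contra fun hab => h a b hab hx⟩
  rw [this]
  exact MeasurableSet.iInter fun a => MeasurableSet.iInter fun b => MeasurableSet.iInter fun _ =>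
    (measurableSet_eq_fun (by fun_prop) (by fun_prop)).compl

/-- The lists with the pattern of ties `s` and with items `x`. -/
def patternLists (s : Setoid (Fin L × Fin m)) (x : Quotient s → 𝕏) : Fin L → Fin m → 𝕏 :=
  fun ℓ i => x (Quotient.mk s (ℓ, i))

@[fun_prop] lemma measurable_patternLists (s : Setoid (Fin L × Fin m)) :
    Measurable (patternLists (𝕏 := 𝕏) s) := by
  unfold patternLists
  fun_prop

open Classical in
/-- The probability that i.i.d. items, arranged according to the pattern of ties `s`, give lists
in `A`. -/
def patternProb (H : Measure 𝕏) (s : Setoid (Fin L × Fin m)) (A : Set (Fin L → Fin m → 𝕏)) :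
    ℝ≥0∞ :=
  (Measure.pi fun _ : Quotient s => H) (patternLists s ⁻¹' A ∩ {x | Function.Injective x})

-- The selected locations are again i.i.d. with law `H`, so the answer does not depend on `ι`.
-- Restricting to distinct items costs nothing almost surely and matches the form of `listsRef`.
open Classical in
lemma measure_patternLists [IsProbabilityMeasure P] [MeasurableEq 𝕏] {H : Measure 𝕏}
    {X : ℕ → Ω → 𝕏} (hX : ∀ j, Measurable (X j)) (hlaw : ∀ j, P.map (X j) = H)
    (hind : iIndepFun X P) (hinj : ∀ᵐ ω ∂P, Function.Injective fun j => X j ω)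
    {A : Set (Fin L → Fin m → 𝕏)} (hA : MeasurableSet A) (s : Setoid (Fin L × Fin m))
    (ι : Quotient s ↪ ℕ) :
    P {ω | (fun ℓ i => X (ι (Quotient.mk s (ℓ, i))) ω) ∈ A} = patternProb H s A := by
  have h1 := (iIndepFun_iff_map_fun_eq_pi_map (fun k => (hX (ι k)).aemeasurable)).1
    (hind.precomp ι.injective)
  simp only [hlaw] at h1
  rw [patternProb, ← h1, Measure.map_apply (by fun_prop)
    ((measurable_patternLists s hA).inter (measurableSet_injective _))]
  refine measure_congr ?_
  filter_upwards [hinj] with ω hω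
  refine propext ⟨fun h => ⟨h, hω.comp ι.injective⟩, fun h => h.1⟩

-- `palm_formula` for the masses, with one chosen point per class and a linear test function of
-- slope `∑ z` for the others.
open Classical in
lemma tsum_lintegral_labelDensity [IsProbabilityMeasure P] (hlam : Measurable lam)
    (hfin : ∫⁻ w in Ioi (0 : ℝ), ENNReal.ofReal (1 - Real.exp (-w)) * (lam w : ℝ≥0∞) < ∞)
    {w : ℕ → Ω → ℝ} (hw : ∀ j, Measurable (w j))
    (hN : IsPoissonProcess P (levyMeasure lam)
      (fun ω => Measure.sum fun j => Measure.dirac (w j ω)))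
    {s : Setoid (Fin L × Fin m)} (hs : Separates s) {z : Fin L → Fin m → ℝ}
    (hz : z ∈ positiveTimes L m) :
    ∑' ι : Quotient s ↪ ℕ,
        ∫⁻ ω, labelDensity (fun j => w j ω) (fun ℓ i => ι (Quotient.mk s (ℓ, i))) z ∂P
      = ENNReal.ofReal (patternDensity lam s z) := by
  have : Countable (Quotient s ↪ ℕ) := DFunLike.coe_injective.countable
  have hZ : 0 ≤ ∑ ℓ, ∑ i, z ℓ i :=
    Finset.sum_nonneg fun ℓ _ => Finset.sum_nonneg fun i _ => (hz ℓ i).le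
  have hk : ∀ k, ∫⁻ y, (Real.toNNReal (y ^ classCard s k *
      Real.exp (-classTime s k z * y)) : ℝ≥0∞) ∂(levyMeasure lam)
      = ENNReal.ofReal (kappa lam (classCard s k) (classTime s k z)) := fun k =>
    lintegral_levyMeasure_kappa hlam hfin (classCard_pos s k) (classTime_pos hs k hz)
  have hφ : ∫⁻ y, (1 - expNeg ((Real.toNNReal (∑ ℓ, ∑ i, z ℓ i) * Real.toNNReal y : ℝ≥0) : ℝ≥0∞))
      ∂(levyMeasure lam) = ENNReal.ofReal (psi lam (∑ ℓ, ∑ i, z ℓ i)) := by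
    rw [← lintegral_levyMeasure_psi hlam hfin hZ]
    simp_rw [ENNReal.coe_mul]
    rfl
  have h := palm_formula hN hw
    (fun k y => Real.toNNReal (y ^ classCard s k * Real.exp (-classTime s k z * y)))
    (fun k => by fun_prop) (fun k => by rw [hk]; exact ENNReal.ofReal_ne_top)
    (fun y => Real.toNNReal (∑ ℓ, ∑ i, z ℓ i) * Real.toNNReal y) (by fun_prop)
  simp only [hk, hφ] at h
  have hmeas : ∀ ι : Quotient s ↪ ℕ, Measurable fun ω =>
      labelDensity (fun j => w j ω) (fun ℓ i => ι (Quotient.mk s (ℓ, i))) z := fun ι =>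
    measurable_labelDensity_left hw _ z
  rw [← lintegral_tsum fun ι => (hmeas ι).aemeasurable]
  rw [expNeg_ofReal (psi_nonneg hZ), ← ENNReal.ofReal_prod_of_nonneg (fun k _ => kappa_nonneg _ _),
    ← ENNReal.ofReal_mul (Finset.prod_nonneg fun k _ => kappa_nonneg _ _), mul_comm] at h
  rw [patternDensity, ← h]
  refine lintegral_congr_ae ?_
  filter_upwards [hN.ae_masses_pos] with ω hω
  refine tsum_congr fun ι => ?_
  exact labelDensity_eq s ι hω hz

-- Label arrays split into a pattern and distinct labels for its classes. Independence of masses and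
-- locations factorises each term, and the location factor is common to all labellings, so only the
-- mass factors are summed.
open Classical in
theorem measure_rectangle_eq [IsProbabilityMeasure P] [MeasurableEq 𝕏] (hlam : Measurable lam)
    (hfin : ∫⁻ w in Ioi (0 : ℝ), ENNReal.ofReal (1 - Real.exp (-w)) * (lam w : ℝ≥0∞) < ∞)
    {H : Measure 𝕏} [IsProbabilityMeasure H] [NullSingletonClass H]
    {G : Ω → Measure 𝕏} (hGm : Measurable G) {w : ℕ → Ω → ℝ} {X : ℕ → Ω → 𝕏}
    (hw : ∀ j, Measurable (w j)) (hX : ∀ j, Measurable (X j))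
    (hN : IsPoissonProcess P (levyMeasure lam)
      (fun ω => Measure.sum fun j => Measure.dirac (w j ω)))
    (hlaw : ∀ j, P.map (X j) = H) (hind : iIndepFun X P)
    (hwX : IndepFun (fun ω j => w j ω) (fun ω j => X j ω) P)
    (hG : ∀ᵐ ω ∂P, G ω = atomicMeasure (fun j => w j ω) (fun j => X j ω))
    {Y : Ω → Fin L → Fin m → 𝕏} {Z : Ω → Fin L → Fin m → ℝ}
    (hYZ : IsPlackettLuceSample P G Y Z) {A : Set (Fin L → Fin m → 𝕏)} (hA : MeasurableSet A)
    {B : Set (Fin L → Fin m → ℝ)} (hB : MeasurableSet B) :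
    P (Y ⁻¹' A ∩ Z ⁻¹' B) = ∑' s : Setoid (Fin L × Fin m),
      if Separates s then patternProb H s A *
        ∫⁻ z in B ∩ positiveTimes L m, ENNReal.ofReal (patternDensity lam s z) else 0 := by
  have hinj := ae_injective_of_iIndepFun hX hlaw hind
  have hBp : MeasurableSet (B ∩ positiveTimes L m) := hB.inter (measurableSet_positiveTimes L m)
  rw [measure_lists_times hGm hw hX hN.ae_masses_pos (hN.ae_sum_masses_lt_top hlam hfin hw) hinj hG
    hYZ hA hB, ← (labelEquiv L m).tsum_eq, ENNReal.tsum_sigma']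
  refine tsum_congr fun s => ?_
  have hsep : ∀ ι : Quotient s ↪ ℕ, (∀ ℓ, Function.Injective (labelEquiv L m ⟨s, ι⟩ ℓ)) ↔
      Separates s := fun ι => forall_congr' fun ℓ =>
    ι.injective.of_comp_iff fun i => Quotient.mk s (ℓ, i)
  simp_rw [hsep]
  split_ifs with hs
  swap
  · simp
  have : Countable (Quotient s ↪ ℕ) := DFunLike.coe_injective.countable
  have hterm : ∀ ι : Quotient s ↪ ℕ,
      ∫⁻ ω, A.indicator 1 (fun ℓ i => X (labelEquiv L m ⟨s, ι⟩ ℓ i) ω) *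
        (∫⁻ z in B ∩ positiveTimes L m,
          labelDensity (fun j => w j ω) (labelEquiv L m ⟨s, ι⟩) z) ∂P
      = patternProb H s A * ∫⁻ z in B ∩ positiveTimes L m,
          ∫⁻ ω, labelDensity (fun j => w j ω) (fun ℓ i => ι (Quotient.mk s (ℓ, i))) z ∂P := by
    intro ι
    rw [labelEquiv_apply]
    set J : Fin L → Fin m → ℕ := fun ℓ i => ι (Quotient.mk s (ℓ, i)) with hJ
    have hf : Measurable fun x : ℕ → 𝕏 => A.indicator (1 : (Fin L → Fin m → 𝕏) → ℝ≥0∞)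
        (fun ℓ i => x (J ℓ i)) := by
      have hJm : Measurable fun (x : ℕ → 𝕏) ℓ i => x (J ℓ i) := by fun_prop
      exact (measurable_one.indicator hA).comp hJm
    have hg : Measurable fun v : ℕ → ℝ =>
        ∫⁻ z in B ∩ positiveTimes L m, labelDensity v J z :=
      (measurable_labelDensity (w := fun j (v : ℕ → ℝ) => v j) (fun j => measurable_pi_apply j)
        J).lintegral_prod_right'
    have hXm : Measurable fun ω j => X j ω := by fun_prop
    have hwm : Measurable fun ω j => w j ω := by fun_prop
    have h1 := lintegral_mul_eq_lintegral_mul_lintegral_of_indepFun'' (hf.comp hXm).aemeasurable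
      (hg.comp hwm).aemeasurable (hwX.symm.comp hf hg)
    simp only [Function.comp_apply] at h1
    rw [h1]
    congr 1
    · rw [← measure_patternLists hX hlaw hind hinj hA s ι]
      have hset : MeasurableSet {ω | (fun ℓ i => X (J ℓ i) ω) ∈ A} := by
        have : Measurable fun ω => (fun ℓ i => X (J ℓ i) ω) := by fun_prop
        exact this hA
      rw [← lintegral_indicator_one hset]
      rfl
    · exact lintegral_lintegral_swap (measurable_labelDensity hw J).aemeasurable
  simp_rw [hterm]
  rw [ENNReal.tsum_mul_left, ← lintegral_tsum]
  · congr 1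
    exact setLIntegral_congr_fun hBp fun z hz =>
      tsum_lintegral_labelDensity hlam hfin hw hN hs hz.2
  · exact fun ι => (measurable_labelDensity hw _).lintegral_prod_left'.aemeasurable

-- On the part of pattern `s` the density splits into `∏ h(x_k)`, which turns the product of `μ`
-- into that of `H`, and a function of the times alone. Patterns that repeat an item inside a list
-- are excluded by the restriction in `listsRef`.
open Classical in
theorem dataRef_withDensity_rectangle [MeasurableEq 𝕏] (hlam : Measurable lam) (μ : Measure 𝕏)
    [SigmaFinite μ] {h : 𝕏 → ℝ≥0} (hh : Measurable h) {A : Set (Fin L → Fin m → 𝕏)}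
    (hA : MeasurableSet A) {B : Set (Fin L → Fin m → ℝ)} (hB : MeasurableSet B) :
    (dataRef μ L m).withDensity (fun p => ENNReal.ofReal (marginalDensity lam h p.1 p.2)) (A ×ˢ B)
      = ∑' s : Setoid (Fin L × Fin m),
      if Separates s then patternProb (μ.withDensity fun x => (h x : ℝ≥0∞)) s A *
        ∫⁻ z in B ∩ positiveTimes L m, ENNReal.ofReal (patternDensity lam s z) else 0 := by
  have hmd := (measurable_marginalDensity (L := L) (m := m) hlam hh).ennreal_ofReal
  have hD : MeasurableSet {y : Fin L → Fin m → 𝕏 | ∀ ℓ, Function.Injective (y ℓ)} := by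
    have : {y : Fin L → Fin m → 𝕏 | ∀ ℓ, Function.Injective (y ℓ)}
        = ⋂ ℓ, (fun y => y ℓ) ⁻¹' {x | Function.Injective x} := by ext; simp
    rw [this]
    exact MeasurableSet.iInter fun ℓ => measurable_pi_apply ℓ (measurableSet_injective _)
  have hM : Measurable fun y : Fin L → Fin m → 𝕏 => ∫⁻ z in B ∩ positiveTimes L m,
      ENNReal.ofReal (marginalDensity lam h y z) := hmd.lintegral_prod_right'
  have hsf : SFinite (listsRef μ L m) := by
    unfold listsRef
    infer_instance
  rw [withDensity_apply _ (hA.prod hB), dataRef, ← Measure.prod_restrict,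
    lintegral_prod _ hmd.aemeasurable, Measure.restrict_restrict hB]
  change ∫⁻ y in A, (∫⁻ z in B ∩ positiveTimes L m,
    ENNReal.ofReal (marginalDensity lam h y z)) ∂(listsRef μ L m) = _
  rw [listsRef, Measure.restrict_restrict hA, Measure.restrict_sum _ (hA.inter hD),
    lintegral_sum_measure]
  refine tsum_congr fun s => ?_
  change ∫⁻ y in A ∩ _, _ ∂(Measure.map (patternLists s) _) = _
  rw [setLIntegral_map (hA.inter hD) hM (measurable_patternLists s),
    Measure.restrict_restrict (measurable_patternLists s (hA.inter hD))]
  have hval : ∀ x : Quotient s → 𝕏, Function.Injective x →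
      ∫⁻ z in B ∩ positiveTimes L m, ENNReal.ofReal (marginalDensity lam h (patternLists s x) z)
      = (∏ k, (h (x k) : ℝ≥0∞)) *
        ∫⁻ z in B ∩ positiveTimes L m, ENNReal.ofReal (patternDensity lam s z) := by
    intro x hx
    have hker : ∀ p q, s p q ↔ patternLists s x p.1 p.2 = patternLists s x q.1 q.2 := fun p q => by
      rw [patternLists, patternLists, hx.eq_iff]
      exact Quotient.eq.symm
    have hout : ∀ k : Quotient s, patternLists s x k.out.1 k.out.2 = x k := fun k =>
      congrArg x (Quotient.out_eq k)
    rw [← lintegral_const_mul _ (measurable_patternDensity hlam s).ennreal_ofReal]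
    refine lintegral_congr fun z => ?_
    rw [marginalDensity_eq hker, ENNReal.ofReal_mul (Finset.prod_nonneg fun _ _ => NNReal.coe_nonneg _),
      ENNReal.ofReal_prod_of_nonneg fun _ _ => NNReal.coe_nonneg _]
    simp_rw [hout, ENNReal.ofReal_coe_nnreal]
  have hsep : ∀ x : Quotient s → 𝕏, Function.Injective x →
      ((∀ ℓ, Function.Injective (patternLists s x ℓ)) ↔ Separates s) := fun x hx =>
    forall_congr' fun ℓ => hx.of_comp_iff fun i => Quotient.mk s (ℓ, i)
  split_ifs with hs
  · have hset : patternLists s ⁻¹' (A ∩ {y | ∀ ℓ, Function.Injective (y ℓ)})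
          ∩ {x : Quotient s → 𝕏 | Function.Injective x}
        = patternLists s ⁻¹' A ∩ {x | Function.Injective x} := by
      ext x
      constructor
      · exact fun hx => ⟨hx.1.1, hx.2⟩
      · exact fun hx => ⟨⟨hx.1, (hsep x hx.2).2 hs⟩, hx.2⟩
    have hmeas : MeasurableSet (patternLists s ⁻¹' A ∩ {x : Quotient s → 𝕏 | Function.Injective x}) :=
      (measurable_patternLists s hA).inter (measurableSet_injective _)
    rw [hset, setLIntegral_congr_fun hmeas fun x hx => hval x hx.2, lintegral_mul_const _
      (by fun_prop), patternProb, pi_withDensity _ _ (fun _ => by fun_prop),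
      withDensity_apply _ hmeas]
  · have hset : patternLists s ⁻¹' (A ∩ {y | ∀ ℓ, Function.Injective (y ℓ)})
          ∩ {x : Quotient s → 𝕏 | Function.Injective x} = ∅ := by
      ext x
      simp only [mem_inter_iff, mem_empty_iff_false, iff_false]
      exact fun hx => hs ((hsep x hx.2).1 hx.1.2)
    rw [hset, Measure.restrict_empty, lintegral_zero_measure]

end Final

end PLCRM

end

theorem mainTheorem4 {Ω 𝕏 : Type*} [MeasurableSpace Ω] [MeasurableSpace 𝕏] [MeasurableEq 𝕏]
    (P : Measure Ω) [IsProbabilityMeasure P]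
    (lam : ℝ → ℝ≥0) (hlam : Measurable lam)
    (hlam_fin : ∫⁻ w in Ioi (0 : ℝ), ENNReal.ofReal (1 - Real.exp (-w)) * (lam w : ℝ≥0∞) < ∞)
    (hlam_inf : ∫⁻ w in Ioi (0 : ℝ), (lam w : ℝ≥0∞) = ∞)
    (μ : Measure 𝕏) [SigmaFinite μ] (h : 𝕏 → ℝ≥0) (hh : Measurable h)
    (H : Measure 𝕏) [IsProbabilityMeasure H] [NullSingletonClass H]
    (hH : H = μ.withDensity (fun x => (h x : ℝ≥0∞)))
    (G : Ω → Measure 𝕏) (hG : PLCRM.IsCRM P lam H G)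
    (L m : ℕ) (Y : Ω → Fin L → Fin m → 𝕏) (Z : Ω → Fin L → Fin m → ℝ)
    (hYZ : PLCRM.IsPlackettLuceSample P G Y Z) :
    (∀ᵐ ω ∂P, 0 < G ω univ ∧ G ω univ < ∞) ∧
    (∀ z : ℝ, 0 ≤ z →
      IntegrableOn (fun w : ℝ => (1 - Real.exp (-z * w)) * (lam w : ℝ)) (Ioi 0) ∧
      -Real.log (∫ ω, Real.exp (-z * (G ω univ).toReal) ∂P) = PLCRM.psi lam z) ∧
    (∀ (n : ℕ) (z : ℝ), 1 ≤ n → 0 < z →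
      IntegrableOn (fun w : ℝ => w ^ n * Real.exp (-z * w) * (lam w : ℝ)) (Ioi 0)) ∧
    P.map (fun ω => (Y ω, Z ω)) =
      (PLCRM.dataRef μ L m).withDensity
        (fun p => ENNReal.ofReal (PLCRM.marginalDensity lam h p.1 p.2)) := by
  obtain ⟨hGm, w, X, hw, hX, hN, hlaw, hind, hwX, hGeq⟩ := hG
  have hpos := hN.ae_masses_pos
  have hfin := hN.ae_sum_masses_lt_top hlam hlam_fin hw
  have hmass : ∀ᵐ ω ∂P, G ω univ = ∑' j, ENNReal.ofReal (w j ω) := by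
    filter_upwards [hGeq] with ω hω
    rw [hω, PLCRM.atomicMeasure_univ]
  refine ⟨?_, fun z hz => ⟨PLCRM.integrableOn_psi hlam hlam_fin hz, ?_⟩,
    fun n z hn hz => PLCRM.integrableOn_kappa hlam hlam_fin hn hz, ?_⟩
  · filter_upwards [hpos, hfin, hmass] with ω hp hf hm
    rw [hm]
    exact ⟨(ENNReal.ofReal_pos.2 (hp 0)).trans_le (ENNReal.le_tsum 0), hf⟩
  · rw [← hN.neg_log_laplace hlam hlam_fin hw hz]
    congr 2
    refine integral_congr_ae ?_
    filter_upwards [hmass] with ω hm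
    rw [hm]
  · have hYm := hYZ.measurable_lists
    have hZm := hYZ.measurable_times
    have : IsProbabilityMeasure (P.map fun ω => (Y ω, Z ω)) :=
      Measure.isProbabilityMeasure_map (by fun_prop)
    -- The joint law is finite, so agreement on rectangles suffices.
    refine Measure.ext_prod fun {A B} hA hB => ?_
    rw [Measure.map_apply (by fun_prop) (hA.prod hB), mk_preimage_prod,
      PLCRM.measure_rectangle_eq hlam hlam_fin hGm hw hX hN hlaw hind hwX hGeq hYZ hA hB,
      PLCRM.dataRef_withDensity_rectangle hlam μ hh hA hB, hH]
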